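/- Let $N\ge 1$, $0\le s\le N$, and let $q=(q_1,\dots,q_N)$ be an $N$-tuple of positive integers with $q_1=\dots=q_s=1$ and $q_k\ge 2$ for $k=s+1,\dots,N$. Let $$P^N_q=\Big\{(z,w)\in\mathbb C^N\times\mathbb C:\ \operatorname{Im} w=\sum_{j=1}^N |z_j^{q_j}|^2\Big\},$$ and let $\mathrm{Aut}(P^N_q,0)$ be its stability group at the origin, i.e. the group (under composition) of germs at $0$ of biholomorphic maps $(\mathbb C^{N+1},0)\to(\mathbb C^{N+1},0)$ that map the germ of $P^N_q$ at $0$ onto itself. It carries the topology induced by the inductive limit topology on germs at $0$ of holomorphic maps, i.e. the finest topology for which, for every open neighbourhood $V$ of $0$, the map sending a holomorphic map on $V$ to its germ at $0$ is continuous with respect to uniform convergence on compact subsets of $V$. Consider the following germs at $0$: * for $\lambda>0$, $\ \Delta_\lambda(z,w)=(\lambda z_1,\dots,\lambda z_s,\lambda^{1/q_{s+1}}z_{s+1},\dots,\lambda^{1/q_N}z_N,\lambda^2w)$; * for a unitary $s\times s$ matrix $\tilde U$ and $\theta=(\theta_{s+1},\dots,\theta_N)\in\mathbb R^{N-s}$,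 $\ \Lambda_{\tilde U,\theta}(z,w)=((z_1,\dots,z_s)\tilde U,e^{i\theta_{s+1}}z_{s+1},\dots,e^{i\theta_N}z_N,w)$; * for $b=(\beta,0)\in\mathbb C^s\times\mathbb C^{N-s}$ (so $b=0$ if $s=0$) and $r\in\mathbb R$, $$\Psi_{b,r}(z,w)=\left(\frac{z_1+\beta_1w}{\delta},\dots,\frac{z_s+\beta_sw}{\delta},\frac{z_{s+1}}{\delta^{1/q_{s+1}}},\dots,\frac{z_N}{\delta^{1/q_N}},\frac w\delta\right),$$ where $\delta=\delta(z,w)=1-2i\sum_{j=1}^N z_j^{q_j}\overline{b_j}-\big(r+i\sum_{j=1}^N|b_j|^2\big)w$ and the roots are the principal ones near $\delta(0,0)=1$; * for a permutation $\sigma$ of $\{s+1,\dots,N\}$ with $q_{\sigma(k)}=q_k$ for all $k$ (an *admissible* permutation), $\ \Sigma_\sigma(z,w)=(z_1,\dots,z_s,z_{\sigma(s+1)},\dots,z_{\sigma(N)},w)$. Then $\mathrm{Aut}(P^N_q,0)$ consists exactly of the germs of the form $$T=\Delta_\lambda\circ\Lambda_{\tilde U,\theta}\circ\Psi_{b,r}\circ\Sigma_\sigma$$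 with $\lambda,\tilde U,\theta,b,r,\sigma$ as above. Its identity component consists exactly of the germs of this form with $\sigma=\mathrm{Id}$. More generally, for each admissible $\sigma$ the germs of this form with that $\sigma$ are exactly the connected component of $\mathrm{Aut}(P^N_q,0)$ containing $\Sigma_\sigma$, and different $\sigma$ give different (disjoint) components. -/

import Mathlib

open Filter Topology

/-- The space `ℂ^N × ℂ` with coordinates `(z, w)`. -/
abbrev CSpace (N : ℕ) : Type := (Fin N → ℂ) × ℂ

/-- The real hypersurface `Im w = ∑ |z_j ^ q_j|²` in `ℂ^N × ℂ`. -/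
def pseudoEllipsoid {N : ℕ} (q : Fin N → ℕ) : Set (CSpace N) :=
  {x | x.2.im = ∑ j, ‖x.1 j ^ q j‖ ^ 2}

/-! ### Germs of holomorphic maps at the origin, with the inductive limit topology -/

/-- Germs at `0` of holomorphic maps `(ℂ^N × ℂ, 0) → ℂ^N × ℂ`. -/
@[ext] structure HolGerm (N : ℕ) where
  germ : Germ (𝓝 (0 : CSpace N)) (CSpace N)
  holo : ∃ f : CSpace N → CSpace N, AnalyticAt ℂ f 0 ∧ germ = ↑f

/-- Maps that are holomorphic on the open neighbourhood `U` of `0`, with the topology of uniform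
convergence on the compact subsets of `U`. (The values outside `U` play no role.) -/
def HolOn {N : ℕ} (U : TopologicalSpace.OpenNhdsOf (0 : CSpace N)) : Type :=
  {F : UniformOnFun (CSpace N) (CSpace N) {K | IsCompact K ∧ K ⊆ (U : Set (CSpace N))} //
    AnalyticOnNhd ℂ (UniformOnFun.toFun _ F) (U : Set (CSpace N))}

instance {N : ℕ} (U : TopologicalSpace.OpenNhdsOf (0 : CSpace N)) : TopologicalSpace (HolOn U) :=
  inferInstanceAs (TopologicalSpace {F : UniformOnFun (CSpace N) (CSpace N)
    {K | IsCompact K ∧ K ⊆ (U : Set (CSpace N))} //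
    AnalyticOnNhd ℂ (UniformOnFun.toFun _ F) (U : Set (CSpace N))})

/-- The germ at `0` of a map that is holomorphic on `U`. -/
noncomputable def HolOn.toGerm {N : ℕ} {U : TopologicalSpace.OpenNhdsOf (0 : CSpace N)} (F : HolOn U) :
    HolGerm N where
  germ := ((UniformOnFun.toFun _ F.1 : CSpace N → CSpace N) : Germ (𝓝 (0 : CSpace N)) (CSpace N))
  holo := ⟨_, F.2 0 U.mem, rfl⟩

/-- The inductive limit topology on germs: the finest topology for which the maps
`𝓞(U) → germs` are continuous, for all open neighbourhoods `U` of `0`. -/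
noncomputable instance {N : ℕ} : TopologicalSpace (HolGerm N) :=
  ⨆ U : TopologicalSpace.OpenNhdsOf (0 : CSpace N),
    TopologicalSpace.coinduced (fun F : HolOn U => F.toGerm) inferInstance

/-! ### The stability group -/

/-- `f` represents a germ at `0` of a biholomorphic map that fixes `0` and maps the germ of `M`
onto itself. -/
structure IsLocalAut {N : ℕ} (M : Set (CSpace N)) (f : CSpace N → CSpace N) : Prop where
  analyticAt : AnalyticAt ℂ f 0
  map_zero : f 0 = 0
  exists_inverse : ∃ g : CSpace N → CSpace N, AnalyticAt ℂ g 0 ∧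
    (∀ᶠ x in 𝓝 0, g (f x) = x) ∧ (∀ᶠ x in 𝓝 0, f (g x) = x)
  mem_iff : ∀ᶠ x in 𝓝 0, (f x ∈ M ↔ x ∈ M)

namespace IsLocalAut

variable {N : ℕ} {M : Set (CSpace N)} {f g : CSpace N → CSpace N}

theorem tendsto (hf : IsLocalAut M f) : Tendsto f (𝓝 0) (𝓝 0) := by
  have h := hf.analyticAt.continuousAt.tendsto
  rwa [hf.map_zero] at h

theorem refl : IsLocalAut M (fun x => x) :=
  ⟨analyticAt_id, rfl, ⟨fun x => x, analyticAt_id, by simp, by simp⟩, by simp⟩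

theorem symm (hf : IsLocalAut M f) (hg : AnalyticAt ℂ g 0) (h1 : ∀ᶠ x in 𝓝 0, g (f x) = x)
    (h2 : ∀ᶠ x in 𝓝 0, f (g x) = x) : IsLocalAut M g := by
  have h0 : g 0 = 0 := by simpa [hf.map_zero] using h1.self_of_nhds
  have ht : Tendsto g (𝓝 0) (𝓝 0) := by
    have h := hg.continuousAt.tendsto
    rwa [h0] at h
  refine ⟨hg, h0, ⟨f, hf.analyticAt, h2, h1⟩, ?_⟩
  filter_upwards [ht.eventually hf.mem_iff, h2] with x hx hx'
  rw [hx'] at hx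
  exact hx.symm

theorem comp (hf : IsLocalAut M f) (hg : IsLocalAut M g) : IsLocalAut M (f ∘ g) := by
  obtain ⟨f', hf', hf1, hf2⟩ := hf.exists_inverse
  obtain ⟨g', hg', hg1, hg2⟩ := hg.exists_inverse
  have sf := hf.symm hf' hf1 hf2
  have sg := hg.symm hg' hg1 hg2
  refine ⟨hf.analyticAt.comp_of_eq hg.analyticAt hg.map_zero, by simp [hg.map_zero, hf.map_zero],
    ⟨g' ∘ f', sg.analyticAt.comp_of_eq sf.analyticAt sf.map_zero, ?_, ?_⟩, ?_⟩
  · filter_upwards [hg1, hg.tendsto.eventually hf1] with x h1 h2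
    simp [h1, h2]
  · filter_upwards [hf2, sf.tendsto.eventually hg2] with x h1 h2
    simp [h1, h2]
  · filter_upwards [hg.mem_iff, hg.tendsto.eventually hf.mem_iff] with x h1 h2
    exact h2.trans h1

end IsLocalAut

/-- `Aut(P_q, 0)`, the germs of local automorphisms of the hypersurface that fix the origin.
As a type it carries the topology induced by the inductive limit topology on germs. -/
def stabilityGroup {N : ℕ} (q : Fin N → ℕ) : Set (HolGerm N) :=
  {T | ∃ f : CSpace N → CSpace N, T.germ = ↑f ∧ IsLocalAut (pseudoEllipsoid q) f}

namespace stabilityGroup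

variable {N : ℕ} {q : Fin N → ℕ}

/-- The element of the stability group represented by `f`. -/
noncomputable def mk (f : CSpace N → CSpace N) (hf : IsLocalAut (pseudoEllipsoid q) f) : stabilityGroup q :=
  ⟨⟨↑f, f, hf.analyticAt, rfl⟩, f, rfl, hf⟩

/-- A representative of an element of the stability group. -/
noncomputable def rep (T : stabilityGroup q) : CSpace N → CSpace N := T.2.choose

theorem germ_eq (T : stabilityGroup q) : T.1.germ = ↑(rep T) := T.2.choose_spec.1

theorem isLocalAut_rep (T : stabilityGroup q) : IsLocalAut (pseudoEllipsoid q) (rep T) :=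
  T.2.choose_spec.2

theorem mk_rep (T : stabilityGroup q) : mk (rep T) (isLocalAut_rep T) = T :=
  Subtype.ext (HolGerm.ext (germ_eq T).symm)

theorem mk_eq_mk {f g : CSpace N → CSpace N} {hf : IsLocalAut (pseudoEllipsoid q) f}
    {hg : IsLocalAut (pseudoEllipsoid q) g} (h : f =ᶠ[𝓝 0] g) : mk f hf = mk g hg :=
  Subtype.ext (HolGerm.ext (Germ.coe_eq.2 h))

theorem rep_mk (f : CSpace N → CSpace N) (hf : IsLocalAut (pseudoEllipsoid q) f) :
    rep (mk f hf) =ᶠ[𝓝 0] f :=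
  (Germ.coe_eq.1 (germ_eq (mk f hf))).symm

/-- A representative of the inverse germ. -/
theorem exists_inv (T : stabilityGroup q) : ∃ g : CSpace N → CSpace N,
    IsLocalAut (pseudoEllipsoid q) g ∧ ∀ᶠ x in 𝓝 0, g (rep T x) = x := by
  obtain ⟨g, hg, h1, h2⟩ := (isLocalAut_rep T).exists_inverse
  exact ⟨g, (isLocalAut_rep T).symm hg h1 h2, h1⟩

noncomputable instance : One (stabilityGroup q) := ⟨mk (fun x => x) IsLocalAut.refl⟩

/-- The product is composition of germs. -/
noncomputable instance : Mul (stabilityGroup q) :=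
  ⟨fun S T => mk (rep S ∘ rep T) ((isLocalAut_rep S).comp (isLocalAut_rep T))⟩

noncomputable instance : Inv (stabilityGroup q) :=
  ⟨fun T => mk (exists_inv T).choose (exists_inv T).choose_spec.1⟩

theorem mk_mul_mk {f g : CSpace N → CSpace N} (hf : IsLocalAut (pseudoEllipsoid q) f)
    (hg : IsLocalAut (pseudoEllipsoid q) g) : mk f hf * mk g hg = mk (f ∘ g) (hf.comp hg) := by
  refine mk_eq_mk ?_
  filter_upwards [rep_mk g hg, hg.tendsto.eventually (rep_mk f hf)] with x h1 h2
  simp [h1, h2]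

noncomputable instance : Group (stabilityGroup q) :=
  Group.ofLeftAxioms
    (fun a b c => by
      rw [← mk_rep a, ← mk_rep b, ← mk_rep c]
      simp only [mk_mul_mk]
      rfl)
    (fun a => by
      rw [← mk_rep a]
      exact mk_mul_mk _ _)
    (fun a => by
      have h : a⁻¹ * mk (rep a) (isLocalAut_rep a) = 1 := by
        refine (mk_mul_mk _ _).trans (mk_eq_mk ?_)
        exact (exists_inv a).choose_spec.2
      rwa [mk_rep] at h)

end stabilityGroup

/-! ### The elementary mappings

Throughout, the coordinates `z_j` with `j < s` are the ones with exponent `q_j = 1`. -/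

/-- The non-isotropic dilation `Δ_t`: `z_j ↦ t ^ (1 / q_j) z_j` and `w ↦ t² w`. -/
noncomputable def dilation {N : ℕ} (q : Fin N → ℕ) (t : ℝ) (x : CSpace N) : CSpace N :=
  (fun j => ((t ^ (1 / (q j : ℝ)) : ℝ) : ℂ) * x.1 j, (t : ℂ) ^ 2 * x.2)

/-- `Λ_{U,θ}`: the row vector of the first `s` coordinates is multiplied by `U` on the right, and
the remaining coordinates are rotated by the angles `θ_j`. -/
noncomputable def blockRotation {N s : ℕ} (hs : s ≤ N) (U : Matrix (Fin s) (Fin s) ℂ)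
    (θ : Fin N → ℝ) (x : CSpace N) : CSpace N :=
  (fun j => if h : j.val < s then
      Matrix.vecMul (fun i : Fin s => x.1 (Fin.castLE hs i)) U ⟨j.val, h⟩
    else Complex.exp (Complex.I * (θ j : ℂ)) * x.1 j, x.2)

/-- `δ(z, w) = 1 - 2i ∑ z_j ^ q_j * conj b_j - (r + i ∑ |b_j|²) w`. -/
noncomputable def deltaFun {N : ℕ} (q : Fin N → ℕ) (b : Fin N → ℂ) (r : ℝ) (x : CSpace N) : ℂ :=
  1 - 2 * Complex.I * ∑ j, x.1 j ^ q j * (starRingEnd ℂ) (b j)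
    - ((r : ℂ) + Complex.I * ∑ j, b j * (starRingEnd ℂ) (b j)) * x.2

/-- `Ψ_{b,r}`. The root `δ ^ (1 / q_j)` is the principal one, which is holomorphic near the origin
because `δ(0) = 1`. -/
noncomputable def fractional {N : ℕ} (s : ℕ) (q : Fin N → ℕ) (b : Fin N → ℂ) (r : ℝ)
    (x : CSpace N) : CSpace N :=
  (fun j => if j.val < s then (x.1 j + b j * x.2) / deltaFun q b r x
    else x.1 j / deltaFun q b r x ^ (1 / (q j : ℂ)), x.2 / deltaFun q b r x)

/-- `Σ_σ(z, w) = (z_σ(1), …, z_σ(N), w)`. -/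
def coordPerm {N : ℕ} (σ : Equiv.Perm (Fin N)) (x : CSpace N) : CSpace N :=
  (fun j => x.1 (σ j), x.2)

/-- The permutations of the coordinates with index `≥ s` that preserve the exponents, as
permutations of all coordinates that fix the first `s`. -/
def admissiblePerms {N : ℕ} (s : ℕ) (q : Fin N → ℕ) : Set (Equiv.Perm (Fin N)) :=
  {σ | (∀ j, j.val < s → σ j = j) ∧ ∀ j, q (σ j) = q j}

/-- The germs at `0` of the maps `Δ_t ∘ Λ_{U,θ} ∘ Ψ_{b,r} ∘ Σ_σ` for a fixed `σ`, where `t > 0`,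
`U` is unitary, `θ` and `r` are real, and `b = (β, 0)` with `β ∈ ℂ^s`. -/
def decomposedGerms {N s : ℕ} (hs : s ≤ N) (q : Fin N → ℕ) (σ : Equiv.Perm (Fin N)) :
    Set (HolGerm N) :=
  {T | ∃ (t : ℝ) (U : Matrix (Fin s) (Fin s) ℂ) (θ : Fin N → ℝ) (b : Fin N → ℂ) (r : ℝ),
    0 < t ∧ U ∈ Matrix.unitaryGroup (Fin s) ℂ ∧ (∀ j, s ≤ j.val → b j = 0) ∧
    T.germ = ↑(dilation q t ∘ blockRotation hs U θ ∘ fractional s q b r ∘ coordPerm σ)}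

open ComplexConjugate

/-! Polarizing the equation of the hypersurface shows that a local automorphism `T` preserves the
relation w - conj ω = 2i ∑ z_j^{q_j} conj(ζ_j^{q_j}) between points (z, w) and (ζ, ω): it maps Segre
varieties to Segre varieties (`segre_relation`). Put φ_j = T_j^{q_j} and let g be the last component
of `T`. In these terms the relation is the one for a quadric in the variables z_j^{q_j}, and the
argument that automorphisms of the quadric are fractional linear goes through, although φ is not
known beforehand to depend on the powers only. The leading coefficients of φ on w = 0 form a matrix
A with A A* = D, where D = ∂g/∂w(0) (`exists_matrix`, `matrix_mul_conjTranspose`). Segre varieties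
of points on the axes give the combinations of the φ_j in terms of g (`eventually_proportional`),
and g is then found from a functional equation for w / g (`exists_snd_eq`). The result is
`exists_fractional_form`: φ and g are fractional linear in (z_k^{q_k}, w), with a unitary matrix U.

Exponents q_j ≥ 2 restrict U and b. As T_j^{q_j} vanishes to order at least two along T_j = 0, the
linear form in its numerator is critical there, which leaves a single z_k^{q_k}, with q_k = q_j and
b_k = 0 (`IsLocalAut.exists_single_coord`). So U is a unitary block on the first s coordinates and a
permutation with phases on the others; taking q_j-th roots gives the decomposition. The converse is
a direct verification for each elementary map.

For the topology, each family with fixed σ is a continuous image of a connected parameter space. For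
j ≥ s the derivative ∂T_j/∂z_k at 0 is continuous in the germ and nonzero exactly when k = σ(j).
Hence each family is clopen and connected, so it is a component. -/

/-! ### Complexification and Segre varieties -/

/-- A holomorphic function on a polydisc that vanishes at the real points vanishes identically. -/
theorem eq_zero_of_eq_zero_on_real {ι : Type*} [Fintype ι] {F : (ι → ℂ) → ℂ} {r : ℝ}
    (hF : DifferentiableOn ℂ F (Metric.ball 0 r))
    (h : ∀ x ∈ Metric.ball (0 : ι → ℂ) r, (∀ i, (x i).im = 0) → F x = 0) :
    ∀ x ∈ Metric.ball (0 : ι → ℂ) r, F x = 0 := by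
  classical
  -- `S` is the set of coordinates that are allowed to be non-real; it grows by one coordinate at a
  -- time, through the identity theorem in one variable.
  have key : ∀ S : Finset ι, ∀ x ∈ Metric.ball (0 : ι → ℂ) r, (∀ i ∉ S, (x i).im = 0) → F x = 0 := by
    intro S
    induction S using Finset.induction_on with
    | empty => exact fun x hx hi => h x hx fun i => hi i (by simp)
    | insert a S ha ih =>
      intro x hx hi
      have hr : 0 < r := lt_of_le_of_lt dist_nonneg hx
      have hmem : ∀ t ∈ Metric.ball (0 : ℂ) r, Function.update x a t ∈ Metric.ball (0 : ι → ℂ) r := by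
        intro t ht
        rw [mem_ball_zero_iff, pi_norm_lt_iff hr] at hx ⊢
        intro i
        rcases eq_or_ne i a with rfl | hia
        · simpa using ht
        · simpa [hia] using hx i
      have hd : DifferentiableOn ℂ (fun t => F (Function.update x a t)) (Metric.ball 0 r) :=
        hF.comp (fun t _ => (hasFDerivAt_update x t).differentiableAt.differentiableWithinAt) hmem
      have hfr : ∃ᶠ t in 𝓝[≠] (0 : ℂ), F (Function.update x a t) = 0 := by
        have ht : Tendsto (fun s : ℝ => (s : ℂ)) (𝓝[≠] 0) (𝓝[≠] 0) := by
          refine tendsto_nhdsWithin_iff.2 ⟨?_, ?_⟩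
          · exact (Complex.continuous_ofReal.tendsto' 0 0 (by simp)).mono_left nhdsWithin_le_nhds
          · filter_upwards [self_mem_nhdsWithin] with s hs
            simpa using hs
        refine ht.frequently (Eventually.frequently ?_)
        have : ∀ᶠ s : ℝ in 𝓝[≠] 0, s ∈ Metric.ball (0 : ℝ) r :=
          nhdsWithin_le_nhds (Metric.ball_mem_nhds _ hr)
        filter_upwards [this] with s hs
        refine ih _ (hmem _ (by simpa using hs)) fun i hiS => ?_
        rcases eq_or_ne i a with rfl | hia
        · simp
        · simpa [hia] using hi i (by simp [hia, hiS])
      have := (hd.analyticOnNhd Metric.isOpen_ball).eqOn_zero_of_preconnected_of_frequently_eq_zero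
        (convex_ball _ _).isPreconnected (Metric.mem_ball_self hr) hfr
      have hxa : x a ∈ Metric.ball (0 : ℂ) r := by
        rw [mem_ball_zero_iff] at hx ⊢
        exact (norm_le_pi_norm x a).trans_lt hx
      simpa using this hxa
  exact fun x hx => key Finset.univ x hx (by simp)

/-- Polarization: a holomorphic map of pseudo-ellipsoids maps the Segre varieties of the first to
those of the second. -/
theorem segre_relation {N : ℕ} {q : Fin N → ℕ} (hq : ∀ j, q j ≠ 0) {T : CSpace N → CSpace N}
    (hT : AnalyticAt ℂ T 0) (hM : ∀ᶠ x in 𝓝 0, x ∈ pseudoEllipsoid q → T x ∈ pseudoEllipsoid q) :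
    ∀ᶠ p : CSpace N × CSpace N in 𝓝 0,
      p.1.2 - conj p.2.2 = 2 * Complex.I * ∑ j, p.1.1 j ^ q j * conj (p.2.1 j ^ q j) →
      (T p.1).2 - conj (T p.2).2 =
        2 * Complex.I * ∑ j, (T p.1).1 j ^ q j * conj ((T p.2).1 j ^ q j) := by
  -- The parameters stand for Re z_j (`inl`), Im z_j (`inr`) and Re w (`none`). For real values `X
  -- v` is a point of the hypersurface and `Y v` its conjugate; for complex values (`X v`, `star (Y
  -- v)`) is a pair satisfying the Segre relation.
  let A : (Option (Fin N ⊕ Fin N) → ℂ) → Fin N → ℂ := fun v j => v (some (.inl j)) + Complex.I * v (some (.inr j))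
  let B : (Option (Fin N ⊕ Fin N) → ℂ) → Fin N → ℂ := fun v j => v (some (.inl j)) - Complex.I * v (some (.inr j))
  let X : (Option (Fin N ⊕ Fin N) → ℂ) → CSpace N := fun v => (A v, v none + Complex.I * ∑ j, A v j ^ q j * B v j ^ q j)
  let Y : (Option (Fin N ⊕ Fin N) → ℂ) → CSpace N := fun v => (B v, v none - Complex.I * ∑ j, A v j ^ q j * B v j ^ q j)
  have hXd : Differentiable ℂ X := by fun_prop
  have hYd : Differentiable ℂ Y := by fun_prop
  have hX0 : X 0 = 0 := by
    ext j <;> simp [X, A, B, hq]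
  have hY0 : Y 0 = 0 := by
    ext j <;> simp [Y, A, B, hq]
  have hXt : Tendsto X (𝓝 0) (𝓝 0) := by simpa [hX0] using hXd.continuous.tendsto 0
  have hYt : Tendsto Y (𝓝 0) (𝓝 0) := by simpa [hY0] using hYd.continuous.tendsto 0
  have hst : Tendsto (star : CSpace N → CSpace N) (𝓝 0) (𝓝 0) := by
    simpa using (continuous_star (R := CSpace N)).tendsto 0
  have hTa : ∀ᶠ x in 𝓝 0, DifferentiableAt ℂ T x :=
    hT.eventually_analyticAt.mono fun x hx => hx.differentiableAt
  obtain ⟨r, hr, hball⟩ := Metric.eventually_nhds_iff_ball.1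
    ((hXt.eventually hTa).and <| ((hst.comp hYt).eventually hTa).and (hXt.eventually hM))
  let F : (Option (Fin N ⊕ Fin N) → ℂ) → ℂ := fun v => (T (X v)).2 - ((star ∘ T ∘ star) (Y v)).2 -
    2 * Complex.I * ∑ j, (T (X v)).1 j ^ q j * ((star ∘ T ∘ star) (Y v)).1 j ^ q j
  have hFd : DifferentiableOn ℂ F (Metric.ball 0 r) := by
    intro v hv
    have h1 : DifferentiableAt ℂ (fun v => T (X v)) v := (hball v hv).1.comp v (hXd v)
    have h2 : DifferentiableAt ℂ (fun v => (star ∘ T ∘ star) (Y v)) v := by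
      have h : DifferentiableAt ℂ (star ∘ T ∘ star) (Y v) := by
        simpa using (hball v hv).2.1.star_star
      exact h.comp (g := star ∘ T ∘ star) v (hYd v)
    have h3 := differentiableAt_pi.1 h1.fst
    have h4 := differentiableAt_pi.1 h2.fst
    exact ((h1.snd.sub h2.snd).sub ((DifferentiableAt.fun_sum fun j _ =>
      ((h3 j).pow (q j)).mul ((h4 j).pow (q j))).const_mul _)).differentiableWithinAt
  have hF0 := eq_zero_of_eq_zero_on_real hFd ?_
  -- The inverse parametrization: on Segre pairs `X (v p) = p.1` and `Y (v p) = star p.2`.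
  · let v : CSpace N × CSpace N → (Option (Fin N ⊕ Fin N) → ℂ) := fun p o => o.elim ((p.1.2 + conj p.2.2) / 2) fun i =>
      i.elim (fun j => (p.1.1 j + conj (p.2.1 j)) / 2)
        fun j => (p.1.1 j - conj (p.2.1 j)) / (2 * Complex.I)
    have hvc : Continuous v := by
      refine continuous_pi fun o => ?_
      rcases o with _ | j | j <;> simp only [v, Option.elim, Sum.elim_inl, Sum.elim_inr]
      · fun_prop
      · fun_prop
      · fun_prop
    have hv0 : v 0 = 0 := by
      ext o
      rcases o with _ | j | j <;> simp [v]
    have hvt : Tendsto v (𝓝 0) (𝓝 0) := by simpa [hv0] using hvc.tendsto 0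
    filter_upwards [hvt.eventually (Metric.ball_mem_nhds 0 hr)] with p hp hrel
    have hI : Complex.I ≠ 0 := Complex.I_ne_zero
    have hA : A (v p) = p.1.1 := by
      ext j
      simp only [A, v, Option.elim, Sum.elim_inl, Sum.elim_inr]
      field_simp
      ring
    have hB : B (v p) = star p.2.1 := by
      ext j
      simp only [B, v, Option.elim, Sum.elim_inl, Sum.elim_inr, Pi.star_apply, RCLike.star_def]
      field_simp
      ring
    have hs : (∑ j, A (v p) j ^ q j * B (v p) j ^ q j) =
        ∑ j, p.1.1 j ^ q j * conj (p.2.1 j ^ q j) := by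
      simp [hA, hB]
    have hX : X (v p) = p.1 := by
      refine Prod.ext hA ?_
      simp only [X, hs]
      simp only [v, Option.elim]
      linear_combination -hrel / 2
    have hY : Y (v p) = star p.2 := by
      refine Prod.ext hB ?_
      simp only [Y, hs]
      simp only [v, Option.elim, Prod.snd_star, RCLike.star_def]
      linear_combination hrel / 2
    have := hF0 (v p) hp
    simp only [F, hX, hY, Function.comp, star_star, Prod.snd_star, Prod.fst_star, Pi.star_apply,
      RCLike.star_def] at this
    simp only [map_pow]
    linear_combination this
  · intro v hv him
    have hre : ∀ i, conj (v i) = v i := fun i => Complex.conj_eq_iff_im.2 (him i)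
    have hAB : ∀ j, B v j = conj (A v j) := fun j => by simp [A, B, hre, sub_eq_add_neg]
    have hsum : ∑ j, A v j ^ q j * B v j ^ q j = ((∑ j, ‖A v j ^ q j‖ ^ 2 : ℝ) : ℂ) := by
      push_cast
      refine Finset.sum_congr rfl fun j _ => ?_
      rw [hAB, ← map_pow, Complex.mul_conj']
    have hYX : star (Y v) = X v := by
      refine Prod.ext (funext fun j => by simp [X, Y, hAB]) ?_
      simp only [X, Y, hsum, Prod.snd_star, RCLike.star_def, map_sub, map_mul, Complex.conj_I,
        hre, Complex.conj_ofReal]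
      ring
    have hXM : X v ∈ pseudoEllipsoid q := by
      have : (v none).im = 0 := him _
      change (v none + Complex.I * ∑ j, A v j ^ q j * B v j ^ q j).im = ∑ j, ‖A v j ^ q j‖ ^ 2
      rw [hsum]
      simp only [Complex.add_im, this, Complex.I_mul_im, Complex.ofReal_re, zero_add]
    have hTM : (T (X v)).2.im = ∑ j, ‖(T (X v)).1 j ^ q j‖ ^ 2 := (hball v hv).2.2 hXM
    have h5 : ∀ j, (T (X v)).1 j ^ q j * conj ((T (X v)).1 j) ^ q j =
        ((‖(T (X v)).1 j ^ q j‖ ^ 2 : ℝ) : ℂ) := fun j => by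
      rw [← map_pow, Complex.mul_conj']
      push_cast
      rfl
    simp only [F, Function.comp, hYX, Prod.snd_star, Prod.fst_star, Pi.star_apply,
      RCLike.star_def, h5, ← Complex.ofReal_sum, ← hTM]
    rw [Complex.sub_conj]
    push_cast
    ring

/-! ### Maps that preserve Segre varieties: leading coefficients -/

/-- The difference quotient of an analytic function in the last variable, along a curve through the
origin. -/
theorem tendsto_sub_div_pow {N : ℕ} {f : CSpace N → ℂ} (hf : AnalyticAt ℂ f 0)
    {p : ℂ → Fin N → ℂ} (hp : Tendsto p (𝓝 0) (𝓝 0)) (c : ℂ) {n : ℕ} (hn : n ≠ 0) :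
    Tendsto (fun t : ℂ => (f (p t, t ^ n * c) - f (p t, 0)) / t ^ n) (𝓝[≠] 0)
      (𝓝 (c * fderiv ℂ f 0 (0, 1))) := by
  have h1 : Tendsto (fun t : ℂ => (((p t, t ^ n * c), (p t, 0)) : CSpace N × CSpace N)) (𝓝[≠] 0)
      (𝓝 (0, 0)) := by
    refine Tendsto.mono_left ?_ nhdsWithin_le_nhds
    have h2 : Tendsto (fun t : ℂ => t ^ n * c) (𝓝 0) (𝓝 0) := by
      have : Continuous fun t : ℂ => t ^ n * c := by fun_prop
      simpa [hn] using this.tendsto 0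
    exact (hp.prodMk_nhds h2).prodMk_nhds (hp.prodMk_nhds tendsto_const_nhds)
  -- Both points of the quotient move with `t`, so strict differentiability is used.
  have h3 := hf.hasStrictFDerivAt.isLittleO.comp_tendsto h1
  have h4 : (fun t : ℂ => f (p t, t ^ n * c) - f (p t, 0) - t ^ n * (c * fderiv ℂ f 0 (0, 1)))
      =o[𝓝[≠] 0] fun t : ℂ => t ^ n := by
    have h5 : (fun t : ℂ => ((0, t ^ n * c) : CSpace N)) =O[𝓝[≠] 0] fun t : ℂ => t ^ n := by
      refine Asymptotics.IsBigO.of_bound ‖c‖ (Eventually.of_forall fun t => ?_)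
      have : 0 ≤ ‖c‖ * ‖t‖ ^ n := by positivity
      simpa [Prod.norm_def, mul_comm] using this
    refine Asymptotics.IsLittleO.trans_isBigO (h3.congr (fun t => ?_) fun t => ?_) h5
    · simp only [Function.comp, Prod.mk_sub_mk, sub_self, sub_zero]
      have : ((0, t ^ n * c) : CSpace N) = (t ^ n * c) • ((0, 1) : CSpace N) := by simp
      rw [this, map_smul, smul_eq_mul]
      ring
    · simp
  have h6 := (h4.tendsto_div_nhds_zero).add_const (c * fderiv ℂ f 0 (0, 1))
  rw [zero_add] at h6
  refine h6.congr' ?_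
  filter_upwards [self_mem_nhdsWithin] with t ht
  have : t ^ n ≠ 0 := pow_ne_zero _ ht
  field_simp
  ring

theorem tendsto_single {N : ℕ} (k : Fin N) :
    Tendsto (fun t : ℂ => (Pi.single k t : Fin N → ℂ)) (𝓝 0) (𝓝 0) := by
  simpa using (continuous_single (A := fun _ : Fin N => ℂ) k).tendsto 0

theorem single_pow {N : ℕ} {q : Fin N → ℕ} (hq : ∀ j, q j ≠ 0) (k : Fin N) (t : ℂ) (j : Fin N) :
    (Pi.single k t : Fin N → ℂ) j ^ q j = if j = k then t ^ q k else 0 := by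
  rcases eq_or_ne j k with rfl | h
  · simp
  · simp [h, hq]

/-- A proper subspace lies in the kernel of a nonzero linear form, and `c` is the coefficient vector
of that form. -/
theorem Submodule.eq_top_of_forall_sum_mul_eq_zero {N : ℕ} {S : Submodule ℂ (Fin N → ℂ)}
    (h : ∀ c : Fin N → ℂ, (∀ v ∈ S, ∑ j, c j * v j = 0) → c = 0) : S = ⊤ := by
  by_contra hS
  obtain ⟨l, hl, hle⟩ := S.exists_le_ker_of_lt_top (lt_top_iff_ne_top.2 hS)
  refine hl ?_
  have hc := h (fun j => l (Pi.single j 1)) fun v hv => by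
    have : l v = 0 := hle hv
    rw [← this, ← LinearMap.sum_single_apply (fun _ : Fin N => ℂ) v]
    simp only [map_sum]
    refine Finset.sum_congr rfl fun j _ => ?_
    rw [mul_comm, ← smul_eq_mul, ← map_smul]
    congr 1
    ext i
    rcases eq_or_ne i j with rfl | hij <;> simp [*]
  refine LinearMap.pi_ext' fun j => LinearMap.ext_ring ?_
  simpa using congrFun hc j

/-- The hypotheses on a map `(φ, g)` that expresses, through the coordinates `(z_j ^ q_j, w)`, that
Segre varieties are mapped to Segre varieties. -/
structure IsSegreMap {N : ℕ} (q : Fin N → ℕ) (φ : CSpace N → Fin N → ℂ) (g : CSpace N → ℂ) :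
    Prop where
  ne_zero : ∀ j, q j ≠ 0
  analyticAt_fst : ∀ j, AnalyticAt ℂ (fun x => φ x j) 0
  analyticAt_snd : AnalyticAt ℂ g 0
  fst_zero : φ 0 = 0
  snd_zero : g 0 = 0
  relation : ∀ᶠ p : CSpace N × CSpace N in 𝓝 0,
    p.1.2 - conj p.2.2 = 2 * Complex.I * ∑ j, p.1.1 j ^ q j * conj (p.2.1 j ^ q j) →
    g p.1 - conj (g p.2) = 2 * Complex.I * ∑ j, φ p.1 j * conj (φ p.2 j)
  independent : ∀ c : Fin N → ℂ, (∀ᶠ z : Fin N → ℂ in 𝓝 0, ∑ j, c j * φ (z, 0) j = 0) → c = 0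
  eq_zero : ∀ᶠ x in 𝓝 0, g x = 0 → x.2 = 0
  deriv_ne_zero : fderiv ℂ g 0 (0, 1) ≠ 0

namespace IsSegreMap

variable {N : ℕ} {q : Fin N → ℕ} {φ : CSpace N → Fin N → ℂ} {g : CSpace N → ℂ}

/-- One common radius for all the local hypotheses, so that points can be chosen explicitly later.
That g vanishes on w = 0 follows by pairing such a point with the origin. -/
theorem exists_ball (h : IsSegreMap q φ g) : ∃ ε > 0,
    (∀ x ∈ Metric.ball (0 : CSpace N) ε, ∀ y ∈ Metric.ball (0 : CSpace N) ε,
      x.2 - conj y.2 = 2 * Complex.I * ∑ j, x.1 j ^ q j * conj (y.1 j ^ q j) →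
      g x - conj (g y) = 2 * Complex.I * ∑ j, φ x j * conj (φ y j)) ∧
    (∀ x ∈ Metric.ball (0 : CSpace N) ε, g x = 0 ↔ x.2 = 0) ∧
    (∀ j, AnalyticOnNhd ℂ (fun x => φ x j) (Metric.ball 0 ε)) ∧
    AnalyticOnNhd ℂ g (Metric.ball 0 ε) := by
  obtain ⟨ε₁, h1, hb1⟩ := Metric.eventually_nhds_iff_ball.1 h.relation
  obtain ⟨ε₂, h2, hb2⟩ := Metric.eventually_nhds_iff_ball.1 (h.eq_zero.and
    (h.analyticAt_snd.eventually_analyticAt.and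
      (eventually_all.2 fun j => (h.analyticAt_fst j).eventually_analyticAt)))
  have hS : ∀ x ∈ Metric.ball (0 : CSpace N) (min ε₁ ε₂), ∀ y ∈ Metric.ball (0 : CSpace N)
      (min ε₁ ε₂), x.2 - conj y.2 = 2 * Complex.I * ∑ j, x.1 j ^ q j * conj (y.1 j ^ q j) →
      g x - conj (g y) = 2 * Complex.I * ∑ j, φ x j * conj (φ y j) := by
    intro x hx y hy
    refine hb1 (x, y) ?_
    rw [mem_ball_zero_iff] at *
    rw [Prod.norm_def]
    exact max_lt (hx.trans_le (min_le_left _ _)) (hy.trans_le (min_le_left _ _))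
  have hlt : ∀ x ∈ Metric.ball (0 : CSpace N) (min ε₁ ε₂), x ∈ Metric.ball (0 : CSpace N) ε₂ :=
    fun x hx => Metric.ball_subset_ball (min_le_right _ _) hx
  refine ⟨min ε₁ ε₂, lt_min h1 h2, hS, fun x hx => ⟨(hb2 x (hlt x hx)).1, fun hx2 => ?_⟩,
    fun j x hx => (hb2 x (hlt x hx)).2.2 j, fun x hx => (hb2 x (hlt x hx)).2.1⟩
  have := hS x hx 0 (Metric.mem_ball_self (lt_min h1 h2)) (by simp [hx2, h.ne_zero])
  simpa [h.fst_zero, h.snd_zero] using this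

/-- The leading coefficients of the restriction of `φ` to the hyperplane `w = 0`. -/
theorem exists_matrix (h : IsSegreMap q φ g) : ∃ A : Matrix (Fin N) (Fin N) ℂ,
    (∀ k j, Tendsto (fun t : ℂ => φ (Pi.single k t, 0) j / t ^ q k) (𝓝[≠] 0) (𝓝 (A k j))) ∧
    ∀ᶠ z : Fin N → ℂ in 𝓝 0, ∀ k, ∑ j, A k j * conj (φ (z, 0) j) = conj (z k) ^ q k *
      (fderiv ℂ g 0 (0, 1) - 2 * Complex.I *
        ∑ j, fderiv ℂ (fun x => φ x j) 0 (0, 1) * conj (φ (z, 0) j)) := by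
  obtain ⟨ε, hε, hS, hg0, -, -⟩ := h.exists_ball
  have hlim : ∀ z : Fin N → ℂ, ‖z‖ < ε → ∀ k,
      Tendsto (fun t : ℂ => ∑ j, conj (φ (z, 0) j) * (φ (Pi.single k t, 0) j / t ^ q k)) (𝓝[≠] 0)
        (𝓝 (conj (z k) ^ q k * (fderiv ℂ g 0 (0, 1) - 2 * Complex.I *
        ∑ j, fderiv ℂ (fun x => φ x j) 0 (0, 1) * conj (φ (z, 0) j)))) := by
    intro z hz k
    -- With this `c` the point (t e_k, t^{q_k} c) lies on the Segre variety of (z, 0) for every t.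
    set c : ℂ := 2 * Complex.I * conj (z k ^ q k) with hc
    have hgl := tendsto_sub_div_pow h.analyticAt_snd (tendsto_single k) c (h.ne_zero k)
    have hfl := fun j => tendsto_sub_div_pow (h.analyticAt_fst j) (tendsto_single k) c (h.ne_zero k)
    have hxz : ((z, 0) : CSpace N) ∈ Metric.ball 0 ε := by
      simpa [Prod.norm_def, hε] using hz
    have hy : Tendsto (fun t : ℂ => ((Pi.single k t, t ^ q k * c) : CSpace N)) (𝓝[≠] 0) (𝓝 0) := by
      refine Tendsto.mono_left ?_ nhdsWithin_le_nhds
      refine (tendsto_single k).prodMk_nhds ?_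
      have : Continuous fun t : ℂ => t ^ q k * c := by fun_prop
      simpa [h.ne_zero k] using this.tendsto 0
    have hy0 : Tendsto (fun t : ℂ => ((Pi.single k t, 0) : CSpace N)) (𝓝[≠] 0) (𝓝 0) :=
      ((tendsto_single k).prodMk_nhds tendsto_const_nhds).mono_left nhdsWithin_le_nhds
    have hsum := tendsto_finsetSum Finset.univ fun j (_ : j ∈ Finset.univ) =>
      (hfl j).const_mul (conj (φ (z, 0) j))
    have hmain := (hgl.div_const (2 * Complex.I)).sub hsum
    have hI : Complex.I ≠ 0 := Complex.I_ne_zero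
    convert hmain.congr' ?_ using 2
    · rw [hc, mul_sub, Finset.mul_sum, Finset.mul_sum, map_pow]
      congr 1
      · field_simp
      · refine Finset.sum_congr rfl fun j _ => ?_
        ring
    · filter_upwards [self_mem_nhdsWithin, hy.eventually (Metric.ball_mem_nhds 0 hε),
        hy0.eventually (Metric.ball_mem_nhds 0 hε)] with t ht hyt hyt0
      have htq : t ^ q k ≠ 0 := pow_ne_zero _ ht
      have hr := hS (z, 0) hxz _ hyt ?_
      · rw [(hg0 (z, 0) hxz).2 rfl] at hr
        have hr' := congrArg conj hr
        simp only [map_sub, map_zero, map_mul, map_ofNat, Complex.conj_I, Complex.conj_conj,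
          map_sum] at hr'
        rw [(hg0 _ hyt0).2 rfl]
        have : g (Pi.single k t, t ^ q k * c) = 2 * Complex.I *
            ∑ j, conj (φ (z, 0) j) * φ (Pi.single k t, t ^ q k * c) j := by
          linear_combination -hr'
        rw [this, sub_zero, mul_div_assoc, mul_div_assoc, ← mul_div_assoc, mul_div_cancel_left₀ _
          (by simp), Finset.sum_div, ← Finset.sum_sub_distrib]
        refine Finset.sum_congr rfl fun j _ => ?_
        field_simp
        ring
      · simp only [single_pow h.ne_zero, apply_ite conj, map_zero, mul_ite, mul_zero,
          Finset.sum_ite_eq', Finset.mem_univ, if_true, hc, map_mul, map_pow, Complex.conj_conj,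
          Complex.conj_I, map_ofNat]
        ring
  have hA : ∀ k j, ∃ l, Tendsto (fun t : ℂ => φ (Pi.single k t, 0) j / t ^ q k) (𝓝[≠] 0)
      (𝓝 l) := by
    intro k
    -- The coefficient vectors for which the quotients converge form a subspace. By `hlim` it
    -- contains conj φ(z, 0) for all small z, and these vectors span by `h.independent`; so every
    -- single coordinate converges.
    let S : Submodule ℂ (Fin N → ℂ) :=
      { carrier := {v | ∃ l, Tendsto (fun t : ℂ => ∑ j, v j * (φ (Pi.single k t, 0) j / t ^ q k))
          (𝓝[≠] 0) (𝓝 l)}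
        add_mem' := by
          rintro a b ⟨l, hl⟩ ⟨m, hm⟩
          refine ⟨l + m, (hl.add hm).congr fun t => ?_⟩
          simp [add_mul, Finset.sum_add_distrib]
        zero_mem' := ⟨0, by simp⟩
        smul_mem' := by
          rintro a b ⟨l, hl⟩
          refine ⟨a * l, (hl.const_mul a).congr fun t => ?_⟩
          simp [mul_assoc, Finset.mul_sum] }
    have hS : S = ⊤ := by
      refine Submodule.eq_top_of_forall_sum_mul_eq_zero fun c hc => ?_
      have := h.independent (fun j => conj (c j)) ?_
      · ext j
        simpa using congrFun this j
      · filter_upwards [Metric.ball_mem_nhds 0 hε] with z hz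
        have := hc (fun j => conj (φ (z, 0) j)) ⟨_, hlim z (by simpa using hz) k⟩
        simpa using congrArg conj this
    intro j
    have : (Pi.single j 1 : Fin N → ℂ) ∈ S := hS ▸ Submodule.mem_top
    obtain ⟨l, hl⟩ := this
    exact ⟨l, by simpa [Pi.single_apply] using hl⟩
  choose A hA using hA
  refine ⟨A, hA, ?_⟩
  filter_upwards [Metric.ball_mem_nhds 0 hε] with z hz k
  refine tendsto_nhds_unique ?_ (hlim z (by simpa using hz) k)
  refine tendsto_finsetSum _ fun j _ => ?_
  rw [mul_comm]
  exact (hA k j).const_mul _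

/-- Put z = t e_l in `hA'`, divide by conj(t)^{q_l} and let t → 0. The bracket on the right tends to
∂g/∂w(0) because φ(0) = 0. -/
theorem matrix_mul_conjTranspose (h : IsSegreMap q φ g) {A : Matrix (Fin N) (Fin N) ℂ}
    (hA : ∀ k j, Tendsto (fun t : ℂ => φ (Pi.single k t, 0) j / t ^ q k) (𝓝[≠] 0) (𝓝 (A k j)))
    (hA' : ∀ᶠ z : Fin N → ℂ in 𝓝 0, ∀ k, ∑ j, A k j * conj (φ (z, 0) j) = conj (z k) ^ q k *
      (fderiv ℂ g 0 (0, 1) - 2 * Complex.I *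
        ∑ j, fderiv ℂ (fun x => φ x j) 0 (0, 1) * conj (φ (z, 0) j))) :
    A * A.conjTranspose = fderiv ℂ g 0 (0, 1) • 1 := by
  ext k l
  have h1 : Tendsto (fun t : ℂ => ∑ j, A k j * conj (φ (Pi.single l t, 0) j / t ^ q l)) (𝓝[≠] 0)
      (𝓝 (∑ j, A k j * conj (A l j))) :=
    tendsto_finsetSum _ fun j _ => (((Complex.continuous_conj.tendsto _).comp (hA l j)).const_mul _)
  have hy0 : Tendsto (fun t : ℂ => ((Pi.single l t, 0) : CSpace N)) (𝓝[≠] 0) (𝓝 0) :=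
    ((tendsto_single l).prodMk_nhds tendsto_const_nhds).mono_left nhdsWithin_le_nhds
  have h2 : ∀ j, Tendsto (fun t : ℂ => conj (φ (Pi.single l t, 0) j)) (𝓝[≠] 0) (𝓝 0) := by
    intro j
    have := (h.analyticAt_fst j).continuousAt.tendsto.comp hy0
    simpa [h.fst_zero, Function.comp_def] using (Complex.continuous_conj.tendsto _).comp this
  have h3 : Tendsto (fun t : ℂ => (1 : Matrix (Fin N) (Fin N) ℂ) k l * (fderiv ℂ g 0 (0, 1) -
      2 * Complex.I * ∑ j, fderiv ℂ (fun x => φ x j) 0 (0, 1) * conj (φ (Pi.single l t, 0) j)))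
      (𝓝[≠] 0) (𝓝 ((1 : Matrix (Fin N) (Fin N) ℂ) k l * fderiv ℂ g 0 (0, 1))) := by
    have := tendsto_finsetSum Finset.univ fun j (_ : j ∈ Finset.univ) =>
      (h2 j).const_mul (fderiv ℂ (fun x => φ x j) 0 (0, 1))
    simpa using ((this.const_mul (2 * Complex.I)).const_sub
      (fderiv ℂ g 0 (0, 1))).const_mul ((1 : Matrix (Fin N) (Fin N) ℂ) k l)
  have h4 := tendsto_nhds_unique h1 (h3.congr' ?_)
  · simpa [Matrix.mul_apply, mul_comm] using h4
  · have := ((tendsto_single l).mono_left (nhdsWithin_le_nhds (s := {0}ᶜ))).eventually hA'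
    filter_upwards [this, self_mem_nhdsWithin] with t ht ht0
    have htq : conj t ^ q l ≠ 0 := pow_ne_zero _ (by simpa using ht0)
    have h5 : ∑ j, A k j * conj (φ (Pi.single l t, 0) j / t ^ q l) =
        (∑ j, A k j * conj (φ (Pi.single l t, 0) j)) / conj t ^ q l := by
      rw [Finset.sum_div]
      refine Finset.sum_congr rfl fun j _ => ?_
      simp [mul_div_assoc]
    rw [h5, ht k]
    rcases eq_or_ne k l with rfl | hkl
    · simp
      field_simp
    · simp [hkl, h.ne_zero]

end IsSegreMap

/-! ### The fractional linear form -/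

/-- An analytic germ that vanishes where `w ≠ 0` vanishes. -/
theorem eventually_eq_zero_of_snd_ne_zero {N : ℕ} {H : CSpace N → ℂ} (hH : AnalyticAt ℂ H 0)
    (h : ∀ᶠ x : CSpace N in 𝓝 0, x.2 ≠ 0 → H x = 0) : ∀ᶠ x in 𝓝 0, H x = 0 := by
  filter_upwards [hH.eventually_analyticAt, h.eventually_nhds] with x hx hx'
  by_cases hx2 : x.2 = 0
  · have hc : Tendsto (fun s : ℂ => ((x.1, s) : CSpace N)) (𝓝[≠] 0) (𝓝 x) := by
      refine Tendsto.mono_left ?_ nhdsWithin_le_nhds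
      have : Continuous fun s : ℂ => ((x.1, s) : CSpace N) := by fun_prop
      refine this.tendsto' _ _ ?_
      rw [← hx2]
    refine tendsto_nhds_unique (hx.continuousAt.tendsto.comp hc) ?_
    refine tendsto_const_nhds.congr' ?_
    filter_upwards [hc.eventually hx', self_mem_nhdsWithin] with s hs hs0
    exact (hs hs0).symm
  · exact hx'.self_of_nhds hx2

theorem analyticAt_deltaFun {N : ℕ} (q : Fin N → ℕ) (b : Fin N → ℂ) (r : ℝ) (x : CSpace N) :
    AnalyticAt ℂ (deltaFun q b r) x := by
  have h1 : ∀ j, AnalyticAt ℂ (fun x : CSpace N => x.1 j) x := fun j =>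
    ((ContinuousLinearMap.proj (R := ℂ) (φ := fun _ : Fin N => ℂ) j).comp
      (ContinuousLinearMap.fst ℂ (Fin N → ℂ) ℂ)).analyticAt x
  have h2 : AnalyticAt ℂ (fun x : CSpace N => x.2) x := analyticAt_snd
  have h3 : AnalyticAt ℂ (fun x : CSpace N => ∑ j, x.1 j ^ q j * conj (b j)) x :=
    Finset.analyticAt_fun_sum _ fun j _ => ((h1 j).pow _).mul analyticAt_const
  exact (analyticAt_const.sub (analyticAt_const.mul h3)).sub (analyticAt_const.mul h2)

theorem deltaFun_zero {N : ℕ} {q : Fin N → ℕ} (hq : ∀ j, q j ≠ 0) (b : Fin N → ℂ) (r : ℝ) :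
    deltaFun q b r 0 = 1 := by
  simp [deltaFun, hq]

theorem eventually_deltaFun_ne_zero {N : ℕ} {q : Fin N → ℕ} (hq : ∀ j, q j ≠ 0) (b : Fin N → ℂ)
    (r : ℝ) : ∀ᶠ x in 𝓝 0, deltaFun q b r x ≠ 0 :=
  (analyticAt_deltaFun q b r 0).continuousAt.eventually_ne (by simp [deltaFun_zero hq])

theorem exists_pow_eq_of_norm_lt {n : ℕ} (hn : n ≠ 0) {c : ℂ} {ε : ℝ} (hε : 0 < ε)
    (hc : ‖c‖ < ε ^ n) : ∃ t : ℂ, t ^ n = c ∧ ‖t‖ < ε := by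
  obtain ⟨t, ht⟩ := IsAlgClosed.exists_pow_nat_eq c (Nat.pos_of_ne_zero hn)
  refine ⟨t, ht, ?_⟩
  rw [← ht, norm_pow] at hc
  exact lt_of_pow_lt_pow_left₀ n hε.le hc

theorem norm_single_eq {N : ℕ} (k : Fin N) (t : ℂ) : ‖(Pi.single k t : Fin N → ℂ)‖ = ‖t‖ :=
  Pi.norm_single (G := fun _ : Fin N => ℂ) (i := k) t

theorem sum_conj_mul_sum {n : ℕ} {A : Matrix (Fin n) (Fin n) ℂ} {d : ℂ}
    (hA : A.conjTranspose * A = d • 1) (u : Fin n → ℂ) (i : Fin n) :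
    ∑ k, conj (A k i) * ∑ j, A k j * u j = d * u i := by
  have := congrFun (congrArg (fun M => Matrix.mulVec M u) hA) i
  simp only [← Matrix.mulVec_mulVec, Matrix.smul_mulVec, Matrix.one_mulVec] at this
  simpa [Matrix.mulVec, dotProduct] using this

namespace IsSegreMap

variable {N : ℕ} {q : Fin N → ℕ} {φ : CSpace N → Fin N → ℂ} {g : CSpace N → ℂ}

/-- The linear combinations of the `φ_j` are proportional to `g`. -/
theorem eventually_proportional (h : IsSegreMap q φ g) {A : Matrix (Fin N) (Fin N) ℂ}
    (hA' : ∀ᶠ z : Fin N → ℂ in 𝓝 0, ∀ k, ∑ j, A k j * conj (φ (z, 0) j) = conj (z k) ^ q k *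
      (fderiv ℂ g 0 (0, 1) - 2 * Complex.I *
        ∑ j, fderiv ℂ (fun x => φ x j) 0 (0, 1) * conj (φ (z, 0) j)))
    (hAA : A.conjTranspose * A = fderiv ℂ g 0 (0, 1) • 1) (k : Fin N) :
    ∀ᶠ x in 𝓝 0, x.2 * (∑ j, conj (A k j) * φ x j - (fderiv ℂ g 0 (0, 1))⁻¹ *
      (∑ j, fderiv ℂ (fun x => φ x j) 0 (0, 1) * conj (A k j)) * g x) =
      x.1 k ^ q k * g x := by
  obtain ⟨ε₁, hε₁, hS, hg0, hφa, hga⟩ := h.exists_ball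
  obtain ⟨ε₂, hε₂, hA'⟩ := Metric.eventually_nhds_iff_ball.1 hA'
  set D := fderiv ℂ g 0 (0, 1) with hDdef
  have hD : D ≠ 0 := h.deriv_ne_zero
  set B : Fin N → ℂ := fun j => fderiv ℂ (fun x => φ x j) 0 (0, 1) with hB
  set β := D⁻¹ * ∑ j, B j * conj (A k j) with hβ
  have hβ' : ∑ j, B j * conj (A k j) = D * β := by
    rw [hβ, mul_inv_cancel_left₀ hD]
  set ε := min ε₁ ε₂ with hεdef
  have hε : 0 < ε := lt_min hε₁ hε₂
  let E : CSpace N → ℂ := fun x => x.2 * (∑ j, conj (A k j) * φ x j - β * g x) - x.1 k ^ q k * g x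
  have hE : AnalyticOnNhd ℂ E (Metric.ball 0 ε₁) := by
    intro x hx
    have h1 : AnalyticAt ℂ (fun x : CSpace N => x.1 k) x :=
      ((ContinuousLinearMap.proj (R := ℂ) (φ := fun _ : Fin N => ℂ) k).comp
        (ContinuousLinearMap.fst ℂ (Fin N → ℂ) ℂ)).analyticAt x
    have h3 : AnalyticAt ℂ (fun x : CSpace N => ∑ j, conj (A k j) * φ x j) x :=
      Finset.analyticAt_fun_sum _ fun j _ => analyticAt_const.mul (hφa j x hx)
    exact (_root_.analyticAt_snd.mul (h3.sub (analyticAt_const.mul (hga x hx)))).sub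
      ((h1.pow _).mul (hga x hx))
  -- Here `x` lies on the Segre variety of (t e_k, 0). By `hA'` only the k-th entry of A conj φ(t
  -- e_k, 0) survives, so φ(t e_k, 0) is a multiple of the k-th row of A, and g is explicit on that
  -- variety.
  have hE0 : ∀ x ∈ Metric.ball (0 : CSpace N) ε₁, ∀ t : ℂ, ‖t‖ < ε →
      x.2 = 2 * Complex.I * (x.1 k ^ q k * conj (t ^ q k)) → E x = 0 := by
    intro x hx t ht hxt
    have hy : ((Pi.single k t, 0) : CSpace N) ∈ Metric.ball 0 ε₁ := by
      simpa [Prod.norm_def, norm_single_eq, hε₁] using ht.trans_le (min_le_left _ _)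
    have hz : (Pi.single k t : Fin N → ℂ) ∈ Metric.ball 0 ε₂ := by
      simpa [norm_single_eq] using ht.trans_le (min_le_right _ _)
    have h1 := hA' _ hz
    set P : Fin N → ℂ := fun j => conj (φ (Pi.single k t, 0) j) with hP
    set ν := D - 2 * Complex.I * ∑ j, B j * P j with hν
    set η := conj (t ^ q k) with hη
    have h1' : ∀ k', ∑ j, A k' j * P j = if k' = k then η * ν else 0 := by
      intro k'
      rw [h1 k', ← map_pow, single_pow h.ne_zero]
      split_ifs <;> simp [hη]
    have h2 : ∀ j, D * P j = conj (A k j) * (η * ν) := by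
      intro j
      rw [← sum_conj_mul_sum hAA P j]
      simp only [h1', mul_ite, mul_zero, Finset.sum_ite_eq', Finset.mem_univ, if_true]
    have h3 : ∑ j, B j * P j = η * ν * β := by
      refine mul_left_cancel₀ hD ?_
      calc D * ∑ j, B j * P j = ∑ j, B j * (D * P j) := by
            rw [Finset.mul_sum]
            exact Finset.sum_congr rfl fun j _ => by ring
        _ = η * ν * ∑ j, B j * conj (A k j) := by
            rw [Finset.mul_sum]
            exact Finset.sum_congr rfl fun j _ => by rw [h2]; ring
        _ = _ := by rw [hβ']; ring
    -- ν is defined through `P`, which is itself a multiple of ν; this is the resulting linear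
    -- equation for ν.
    have h4 : ν * (1 + 2 * Complex.I * η * β) = D := by
      rw [h3] at hν
      linear_combination hν
    have h5 := hS x hx _ hy (by
      simp only [single_pow h.ne_zero, apply_ite conj, map_zero, mul_ite, mul_zero,
          Finset.sum_ite_eq', Finset.mem_univ, if_true]
      rw [hxt, sub_zero])
    rw [(hg0 _ hy).2 rfl, map_zero, sub_zero] at h5
    have h6 : D * g x = 2 * Complex.I * (η * ν) * ∑ j, conj (A k j) * φ x j := by
      rw [h5, Finset.mul_sum, Finset.mul_sum, Finset.mul_sum]
      refine Finset.sum_congr rfl fun j _ => ?_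
      linear_combination 2 * Complex.I * φ x j * h2 j
    set Φ := ∑ j, conj (A k j) * φ x j with hΦ
    have hν0 : ν ≠ 0 := fun h0 => hD (by rw [← h4, h0, zero_mul])
    have h7 : (1 + 2 * Complex.I * η * β) * g x = 2 * Complex.I * η * Φ := by
      refine mul_left_cancel₀ hν0 ?_
      linear_combination h6 + g x * h4
    change x.2 * (Φ - β * g x) - x.1 k ^ q k * g x = 0
    rw [hxt]
    linear_combination -(x.1 k ^ q k) * h7
  -- The Segre varieties in `hE0` fill a neighbourhood of a point (z, 0) with z_k ≠ 0: for small w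
  -- the equation can be solved for t. The identity theorem then gives E = 0 on the whole ball.
  have hzero : Set.EqOn E 0 (Metric.ball 0 ε₁) := by
    refine hE.eqOn_of_preconnected_of_eventuallyEq analyticOnNhd_const
      (convex_ball _ _).isPreconnected (z₀ := (Pi.single k ((ε₁ / 2 : ℝ) : ℂ), 0)) ?_ ?_
    · simp [Prod.norm_def, norm_single_eq, hε₁, abs_of_pos hε₁]
    · have hopen : IsOpen {x : CSpace N | ‖x.2‖ < ε ^ q k * ‖2 * Complex.I * x.1 k ^ q k‖} :=
        isOpen_lt (by fun_prop) (by fun_prop)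
      have hb : ((Pi.single k ((ε₁ / 2 : ℝ) : ℂ), 0) : CSpace N) ∈ Metric.ball 0 ε₁ := by
        simp [Prod.norm_def, norm_single_eq, hε₁, abs_of_pos hε₁]
      filter_upwards [Metric.isOpen_ball.mem_nhds hb, hopen.mem_nhds (by
        simp only [Set.mem_ofPred_eq, norm_zero, Pi.single_eq_same]
        have : (0 : ℝ) < ‖2 * Complex.I * ((ε₁ / 2 : ℝ) : ℂ) ^ q k‖ := by
          have : ((ε₁ / 2 : ℝ) : ℂ) ≠ 0 := by exact_mod_cast (half_pos hε₁).ne'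
          exact norm_pos_iff.2 (mul_ne_zero (by simp) (pow_ne_zero _ this))
        positivity)] with x hx hx'
      have hx0 : 2 * Complex.I * x.1 k ^ q k ≠ 0 := by
        intro h0
        simp only [h0, norm_zero, mul_zero] at hx'
        exact absurd hx' (not_lt.2 (norm_nonneg _))
      obtain ⟨t, ht, htε⟩ := exists_pow_eq_of_norm_lt (h.ne_zero k) hε
        (c := x.2 / (2 * Complex.I * x.1 k ^ q k)) (by
          rwa [norm_div, div_lt_iff₀ (norm_pos_iff.2 hx0)])
      refine hE0 x hx (conj t) (by simpa using htε) ?_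
      rw [← map_pow, Complex.conj_conj, ht]
      have hx0' := right_ne_zero_of_mul hx0
      field_simp
  filter_upwards [Metric.ball_mem_nhds 0 hε₁] with x hx
  exact sub_eq_zero.1 (hzero hx)

/-- The fractional linear form of the last component. -/
theorem exists_snd_eq (h : IsSegreMap q φ g) (hN : 0 < N) {A : Matrix (Fin N) (Fin N) ℂ}
    {b : Fin N → ℂ} {d : ℝ} (hAA : A.conjTranspose * A = (d : ℂ) • 1)
    (hE : ∀ k, ∀ᶠ x in 𝓝 0, x.2 * (∑ j, conj (A k j) * φ x j - b k * g x) = x.1 k ^ q k * g x) :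
    ∃ r : ℝ, ∀ᶠ x in 𝓝 0, deltaFun q b r x * g x = d * x.2 := by
  obtain ⟨ε₁, hε₁, hS, hg0, hφa, hga⟩ := h.exists_ball
  obtain ⟨ε₂, hε₂, hE⟩ := Metric.eventually_nhds_iff_ball.1 (eventually_all.2 hE)
  set ε := min ε₁ ε₂ with hεdef
  have hε : 0 < ε := lt_min hε₁ hε₂
  have hb1 : ∀ x ∈ Metric.ball (0 : CSpace N) ε, x ∈ Metric.ball (0 : CSpace N) ε₁ :=
    Metric.ball_subset_ball (min_le_left _ _)
  have hb2 : ∀ x ∈ Metric.ball (0 : CSpace N) ε, x ∈ Metric.ball (0 : CSpace N) ε₂ :=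
    Metric.ball_subset_ball (min_le_right _ _)
  -- Multiplication by `m` turns Φ_k into z_k^{q_k} + b_k w by `hE`. The goal becomes d m = δ.
  let m : CSpace N → ℂ := fun x => x.2 / g x
  let Φ : CSpace N → Fin N → ℂ := fun x k => ∑ j, conj (A k j) * φ x j
  let L : CSpace N → ℂ := fun x => ∑ k, x.1 k ^ q k * conj (b k)
  set S : ℂ := ∑ k, b k * conj (b k) with hSdef
  have hSr : conj S = S := by
    rw [hSdef, map_sum]
    exact Finset.sum_congr rfl fun k _ => by simp [mul_comm]
  have hgne : ∀ x ∈ Metric.ball (0 : CSpace N) ε, x.2 ≠ 0 → g x ≠ 0 :=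
    fun x hx hx2 h0 => hx2 ((hg0 x (hb1 x hx)).1 h0)
  have hmg : ∀ x ∈ Metric.ball (0 : CSpace N) ε, x.2 ≠ 0 → m x * g x = x.2 :=
    fun x hx hx2 => div_mul_cancel₀ _ (hgne x hx hx2)
  have hmΦ : ∀ x ∈ Metric.ball (0 : CSpace N) ε, x.2 ≠ 0 → ∀ k,
      m x * Φ x k = x.1 k ^ q k + b k * x.2 := by
    intro x hx hx2 k
    have h1 := hE x (hb2 x hx) k
    have h2 := hgne x hx hx2
    refine mul_right_cancel₀ h2 ?_
    linear_combination h1 + Φ x k * hmg x hx hx2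
  have hΦφ : ∀ x y, ∑ k, Φ x k * conj (Φ y k) = d * ∑ j, φ x j * conj (φ y j) := by
    intro x y
    have h1 : ∀ k, conj (Φ y k) = ∑ j, A k j * conj (φ y j) := fun k => by simp [Φ]
    calc ∑ k, Φ x k * conj (Φ y k)
        = ∑ k, ∑ i, φ x i * (conj (A k i) * ∑ j, A k j * conj (φ y j)) := by
          refine Finset.sum_congr rfl fun k _ => ?_
          rw [h1, Finset.sum_mul]
          exact Finset.sum_congr rfl fun i _ => by ring
      _ = _ := by
          rw [Finset.sum_comm, Finset.mul_sum]
          refine Finset.sum_congr rfl fun i _ => ?_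
          rw [← Finset.mul_sum, sum_conj_mul_sum hAA]
          ring
  -- The Segre relation for (φ, g) times d m(x) conj(m(y)), which leaves an equation in `m` alone.
  have c1 : ∀ x ∈ Metric.ball (0 : CSpace N) ε, ∀ y ∈ Metric.ball (0 : CSpace N) ε,
      x.2 ≠ 0 → y.2 ≠ 0 →
      x.2 - conj y.2 = 2 * Complex.I * ∑ j, x.1 j ^ q j * conj (y.1 j ^ q j) →
      d * (x.2 * conj (m y) - conj y.2 * m x) = x.2 - conj y.2 +
        2 * Complex.I * (conj y.2 * L x + x.2 * conj (L y) + x.2 * conj y.2 * S) := by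
    intro x hx y hy hx2 hy2 hxy
    have h1 := hS x (hb1 x hx) y (hb1 y hy) hxy
    have h2 : ∑ k, (m x * Φ x k) * conj (m y * Φ y k) =
        m x * conj (m y) * (d * ∑ j, φ x j * conj (φ y j)) := by
      rw [← hΦφ, Finset.mul_sum]
      exact Finset.sum_congr rfl fun k _ => by rw [map_mul]; ring
    have h3 : ∑ k, (m x * Φ x k) * conj (m y * Φ y k) =
        (∑ j, x.1 j ^ q j * conj (y.1 j ^ q j)) + (conj y.2 * L x + x.2 * conj (L y) +
          x.2 * conj y.2 * S) := by
      simp only [hmΦ x hx hx2, hmΦ y hy hy2, L, hSdef, map_sum, Finset.mul_sum,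
        ← Finset.sum_add_distrib]
      refine Finset.sum_congr rfl fun k _ => ?_
      simp only [map_add, map_mul, Complex.conj_conj]
      ring
    have h4 := hmg x hx hx2
    have h5 := congrArg conj (hmg y hy hy2)
    rw [map_mul] at h5
    linear_combination (d * m x * conj (m y)) * h1 - hxy - d * conj (m y) * h4 +
      d * m x * h5 - 2 * Complex.I * h2 + 2 * Complex.I * h3
  have hL0 : ∀ w : ℂ, L (0, w) = 0 := fun w => by simp [L, h.ne_zero]
  have hball : ∀ w : ℂ, ‖w‖ < ε → ((0, w) : CSpace N) ∈ Metric.ball 0 ε := fun w hw => by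
    simpa [Prod.norm_def, hε] using hw
  have c2 : ∀ x ∈ Metric.ball (0 : CSpace N) ε, x.2 ≠ 0 →
      d * m x = d * conj (m (0, conj x.2)) - 2 * Complex.I * (L x + S * x.2) := by
    intro x hx hx2
    have hxn : ‖x.2‖ < ε := (norm_snd_le x).trans_lt (by simpa using hx)
    have h1 := c1 x hx (0, conj x.2) (hball _ (by simpa using hxn)) hx2 (by simpa using hx2)
      (by simp [h.ne_zero])
    simp only [Complex.conj_conj, hL0, map_zero, mul_zero, sub_self] at h1
    refine mul_left_cancel₀ hx2 ?_
    linear_combination -h1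
  let n : ℂ → ℂ := fun w => d * m (0, w) + Complex.I * S * w
  have c3 : ∀ w : ℂ, ‖w‖ < ε → w ≠ 0 → conj (n (conj w)) = n w := by
    intro w hw hw0
    have h1 := c2 (0, w) (hball w hw) hw0
    simp only [hL0, zero_add] at h1
    simp only [n, map_add, map_mul, Complex.conj_ofReal, Complex.conj_I, Complex.conj_conj, hSr]
    linear_combination -h1
  have c3' : ∀ x ∈ Metric.ball (0 : CSpace N) ε, x.2 ≠ 0 →
      d * m x = n x.2 - 2 * Complex.I * L x - Complex.I * S * x.2 := by
    intro x hx hx2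
    have hxn : ‖x.2‖ < ε := (norm_snd_le x).trans_lt (by simpa using hx)
    have h1 := c2 x hx hx2
    have h2 := c3 x.2 hxn hx2
    simp only [n, map_add, map_mul, Complex.conj_ofReal, Complex.conj_I, Complex.conj_conj,
      hSr] at h2 ⊢
    linear_combination h1 + h2
  let k₀ : Fin N := ⟨0, hN⟩
  have hQ : q k₀ * 2 ≠ 0 := mul_ne_zero (h.ne_zero _) two_ne_zero
  set ε' := min ε (ε ^ (q k₀ * 2)) with hε'def
  have hε' : 0 < ε' := lt_min hε (by positivity)
  -- Arbitrary small w and τ occur in one Segre pair: for (a e_k, w) and (conj(a) e_k, conj τ) the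
  -- relation reads w - τ = 2i a^{2 q_k}, whence the exponent `q k₀ * 2`. The conclusion says that
  -- (1 - n(w)) / w is constant.
  have c4 : ∀ w τ : ℂ, ‖w‖ < ε' → ‖τ‖ < ε' → w ≠ 0 → τ ≠ 0 → n τ * w - n w * τ = w - τ := by
    intro w τ hw hτ hw0 hτ0
    obtain ⟨a, ha, haε⟩ := exists_pow_eq_of_norm_lt hQ hε (c := (w - τ) / (2 * Complex.I)) (by
      have h1 : ‖(w - τ) / (2 * Complex.I)‖ = ‖w - τ‖ / 2 := by simp
      rw [h1]
      have h2 := norm_sub_le w τ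
      have h3 : ε' ≤ ε ^ (q k₀ * 2) := min_le_right _ _
      linarith)
    have hwε : ‖w‖ < ε := hw.trans_le (min_le_left _ _)
    have hτε : ‖τ‖ < ε := hτ.trans_le (min_le_left _ _)
    have hx : ((Pi.single k₀ a, w) : CSpace N) ∈ Metric.ball 0 ε := by
      simp [Prod.norm_def, norm_single_eq, haε, hwε]
    have hy : ((Pi.single k₀ (conj a), conj τ) : CSpace N) ∈ Metric.ball 0 ε := by
      simp [Prod.norm_def, norm_single_eq, haε, hτε]
    have h1 := c1 _ hx _ hy hw0 (by simpa using hτ0) (by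
      simp only [single_pow h.ne_zero, apply_ite conj, map_zero, mul_ite, mul_zero,
          Finset.sum_ite_eq', Finset.mem_univ, if_true, Complex.conj_conj, map_pow]
      rw [← pow_add, ← mul_two, ha]
      field_simp)
    have h2 := c3' _ hx hw0
    have h3 := congrArg conj (c3' _ hy (by simpa using hτ0))
    have h4 := c3 τ hτε hτ0
    simp only [map_sub, map_mul, Complex.conj_ofReal, Complex.conj_I, Complex.conj_conj,
      hSr, map_ofNat, h4] at h1 h2 h3
    linear_combination h1 - w * h3 + τ * h2
  set τ₀ : ℝ := ε' / 2 with hτ₀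
  have hτ₀0 : (τ₀ : ℂ) ≠ 0 := by exact_mod_cast (half_pos hε').ne'
  have hτn : ‖(τ₀ : ℂ)‖ < ε' := by
    rw [Complex.norm_real, Real.norm_of_nonneg (half_pos hε').le]
    exact half_lt_self hε'
  have hnr : conj (n τ₀) = n τ₀ := by
    have := c3 τ₀ (hτn.trans_le (min_le_left _ _)) hτ₀0
    rwa [Complex.conj_ofReal] at this
  obtain ⟨ρ, hρ⟩ := Complex.conj_eq_iff_real.1 hnr
  -- The constant from `c4`, evaluated at τ₀; it is real because n(τ₀) is.
  refine ⟨(1 - ρ) / τ₀, ?_⟩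
  filter_upwards [Metric.ball_mem_nhds 0 hε'] with x hx
  have hxε : x ∈ Metric.ball (0 : CSpace N) ε := Metric.ball_subset_ball (min_le_left _ _) hx
  by_cases hx2 : x.2 = 0
  · rw [(hg0 x (hb1 x hxε)).2 hx2, hx2, mul_zero, mul_zero]
  · have hxn : ‖x.2‖ < ε' := (norm_snd_le x).trans_lt (by simpa using hx)
    have h1 := c4 x.2 τ₀ hxn hτn hx2 hτ₀0
    rw [hρ] at h1
    have h2 := c3' x hxε hx2
    have h3 := hmg x hxε hx2
    have h4 : deltaFun q b ((1 - ρ) / τ₀) x = d * m x := by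
      rw [h2]
      simp only [deltaFun, L, ← hSdef]
      push_cast
      have h5 : n x.2 = 1 - (1 - ρ) / τ₀ * x.2 := by
        field_simp
        linear_combination -h1
      rw [h5]
      ring
    rw [h4, ← h3]
    ring

/-- A map that preserves Segre varieties is fractional linear in the coordinates
`(z_j ^ q_j, w)`. -/
theorem exists_fractional_form (h : IsSegreMap q φ g) (hN : 0 < N) :
    ∃ (t : ℝ) (U : Matrix (Fin N) (Fin N) ℂ) (b : Fin N → ℂ) (r : ℝ), 0 < t ∧
      U ∈ Matrix.unitaryGroup (Fin N) ℂ ∧ ∀ᶠ x in 𝓝 0,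
      (∀ j, φ x j = t * (∑ k, (x.1 k ^ q k + b k * x.2) * U k j) / deltaFun q b r x) ∧
      g x = t ^ 2 * x.2 / deltaFun q b r x := by
  obtain ⟨A, hA, hA'⟩ := h.exists_matrix
  have hAA := h.matrix_mul_conjTranspose hA hA'
  have hD := h.deriv_ne_zero
  -- ∂g/∂w(0) is a diagonal entry of A A*, hence nonnegative, and it is nonzero by hypothesis.
  obtain ⟨d, hd, hdD⟩ : ∃ d : ℝ, 0 < d ∧ fderiv ℂ g 0 (0, 1) = d := by
    have h1 := congrFun (congrFun hAA ⟨0, hN⟩) ⟨0, hN⟩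
    simp only [Matrix.mul_apply, Matrix.conjTranspose_apply, RCLike.star_def, Complex.mul_conj,
      Matrix.smul_apply, Matrix.one_apply_eq, smul_eq_mul, mul_one] at h1
    rw [← Complex.ofReal_sum] at h1
    refine ⟨_, lt_of_le_of_ne (Finset.sum_nonneg fun j _ => Complex.normSq_nonneg _) ?_, h1.symm⟩
    intro h0
    rw [← h0] at h1
    exact hD (by simpa using h1.symm)
  have hAA' : A.conjTranspose * A = fderiv ℂ g 0 (0, 1) • 1 := by
    have h1 : A * ((fderiv ℂ g 0 (0, 1))⁻¹ • A.conjTranspose) = 1 := by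
      rw [Matrix.mul_smul, hAA, inv_smul_smul₀ hD]
    rw [mul_eq_one_comm, Matrix.smul_mul] at h1
    rw [← h1, smul_inv_smul₀ hD]
  have hE := h.eventually_proportional hA' hAA'
  rw [hdD] at hAA hAA' hE
  set b : Fin N → ℂ := fun k => (d : ℂ)⁻¹ * ∑ j, fderiv ℂ (fun x => φ x j) 0 (0, 1) * conj (A k j)
    with hb
  obtain ⟨r, hr⟩ := h.exists_snd_eq hN (b := b) hAA' hE
  have hs : (√d : ℂ) ≠ 0 := by exact_mod_cast (Real.sqrt_pos.2 hd).ne'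
  have hss : (√d : ℂ) * √d = d := by exact_mod_cast Real.mul_self_sqrt hd.le
  refine ⟨√d, (√d : ℂ)⁻¹ • A, b, r, Real.sqrt_pos.2 hd, ?_, ?_⟩
  · rw [Matrix.mem_unitaryGroup_iff, Matrix.star_eq_conjTranspose, Matrix.conjTranspose_smul,
      Matrix.smul_mul, Matrix.mul_smul, hAA, smul_smul, smul_smul]
    have : (√d : ℂ)⁻¹ * (star (√d : ℂ)⁻¹ * d) = 1 := by
      rw [← hss]
      simp only [star_inv₀, RCLike.star_def, Complex.conj_ofReal]
      field_simp
    rw [← mul_assoc] at this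
    rw [mul_assoc, ← mul_assoc, this, one_smul]
  · have hδ := eventually_deltaFun_ne_zero h.ne_zero b r
    have hΦ : ∀ k, ∀ᶠ x in 𝓝 0, deltaFun q b r x * ∑ j, conj (A k j) * φ x j -
        d * (x.1 k ^ q k + b k * x.2) = 0 := by
      intro k
      -- `hE k` and `hr` give the identity only after multiplication by w.
      refine eventually_eq_zero_of_snd_ne_zero ?_ ?_
      · have h1 : AnalyticAt ℂ (fun x : CSpace N => x.1 k) 0 :=
          ((ContinuousLinearMap.proj (R := ℂ) (φ := fun _ : Fin N => ℂ) k).comp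
            (ContinuousLinearMap.fst ℂ (Fin N → ℂ) ℂ)).analyticAt 0
        have h3 : AnalyticAt ℂ (fun x : CSpace N => ∑ j, conj (A k j) * φ x j) 0 :=
          Finset.analyticAt_fun_sum _ fun j _ => analyticAt_const.mul (h.analyticAt_fst j)
        exact ((analyticAt_deltaFun q b r 0).mul h3).sub (analyticAt_const.mul
          ((h1.pow _).add (analyticAt_const.mul _root_.analyticAt_snd)))
      · filter_upwards [hE k, hr] with x hx hx' hx2
        refine mul_left_cancel₀ hx2 ?_
        linear_combination deltaFun q b r x * hx + (b k * x.2 + x.1 k ^ q k) * hx'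
    filter_upwards [eventually_all.2 hΦ, hr, hδ] with x hx hx' hδx
    refine ⟨fun j => ?_, ?_⟩
    · have h1 := sum_conj_mul_sum (A := A.map conj) (d := d) (by
        have := congrArg (fun M => M.map conj) hAA'
        ext i j
        have := congrFun (congrFun this i) j
        simp [Matrix.mul_apply, Matrix.one_apply, apply_ite conj] at this ⊢
        exact this) (φ x) j
      simp only [Matrix.map_apply, Complex.conj_conj] at h1
      have hdc : (d : ℂ) ≠ 0 := by exact_mod_cast hd.ne'
      rw [eq_div_iff hδx]
      refine mul_left_cancel₀ hdc ?_
      rw [← mul_assoc, ← h1, Finset.sum_mul, Finset.mul_sum, Finset.mul_sum]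
      refine Finset.sum_congr rfl fun k _ => ?_
      have h2 := hx k
      simp only [Matrix.smul_apply, smul_eq_mul]
      field_simp
      linear_combination A k j * h2
    · rw [eq_div_iff hδx]
      rw [mul_comm, hx', sq, hss]

end IsSegreMap

/-! ### Local automorphisms as Segre maps -/

/-- The `j`-th coordinate of `z` as a continuous linear form on `ℂ^N × ℂ`. -/
noncomputable def coordCLM {N : ℕ} (j : Fin N) : CSpace N →L[ℂ] ℂ :=
  (ContinuousLinearMap.proj (R := ℂ) (φ := fun _ : Fin N => ℂ) j).comp
    (ContinuousLinearMap.fst ℂ (Fin N → ℂ) ℂ)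

@[simp] theorem coordCLM_apply {N : ℕ} (j : Fin N) (x : CSpace N) : coordCLM j x = x.1 j := rfl

theorem AnalyticAt.coord {N : ℕ} {E : Type*} [NormedAddCommGroup E] [NormedSpace ℂ E]
    {f : E → CSpace N} {x : E} (hf : AnalyticAt ℂ f x) (j : Fin N) :
    AnalyticAt ℂ (fun y => (f y).1 j) x :=
  ((coordCLM j).analyticAt _).comp hf

namespace IsLocalAut

variable {N : ℕ} {M : Set (CSpace N)} {q : Fin N → ℕ} {T : CSpace N → CSpace N}

theorem exists_inverse_isLocalAut (hT : IsLocalAut M T) : ∃ G : CSpace N → CSpace N,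
    IsLocalAut M G ∧ (∀ᶠ x in 𝓝 0, G (T x) = x) ∧ (∀ᶠ x in 𝓝 0, T (G x) = x) := by
  obtain ⟨G, hG, h1, h2⟩ := hT.exists_inverse
  exact ⟨G, hT.symm hG h1 h2, h1, h2⟩

theorem eventually_snd_eq_zero (hq : ∀ j, q j ≠ 0) (hT : IsLocalAut (pseudoEllipsoid q) T) :
    ∀ᶠ x in 𝓝 0, x.2 = 0 → (T x).2 = 0 := by
  have h := segre_relation hq hT.analyticAt (hT.mem_iff.mono fun x hx => hx.2)
  have ht : Tendsto (fun x : CSpace N => (x, (0 : CSpace N))) (𝓝 0) (𝓝 0) :=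
    tendsto_id.prodMk_nhds tendsto_const_nhds
  filter_upwards [ht.eventually h] with x hx hx2
  have := hx (by simp [hx2, hq])
  simpa [hT.map_zero, hq] using this

theorem fderiv_comp_eq {G : CSpace N → CSpace N} (hT : AnalyticAt ℂ T 0) (hT0 : T 0 = 0)
    (hG : AnalyticAt ℂ G 0) (h : ∀ᶠ x in 𝓝 0, G (T x) = x) (v : CSpace N) :
    fderiv ℂ G 0 (fderiv ℂ T 0 v) = v := by
  have h1 : HasFDerivAt G (fderiv ℂ G 0) (T 0) := by
    rw [hT0]
    exact hG.differentiableAt.hasFDerivAt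
  have h2 := h1.comp 0 hT.differentiableAt.hasFDerivAt
  have h3 : HasFDerivAt (fun x => x) _ (0 : CSpace N) :=
    h2.congr_of_eventuallyEq (h.mono fun x hx => hx.symm)
  have h4 := h3.unique (hasFDerivAt_id 0)
  exact congrArg (fun L => L v) h4

/-- The nondegeneracy conditions come from the inverse `G`, which also preserves w = 0. Substituting
`G` turns a linear relation among the φ_j on w = 0 into ∑ c_j u_j^{q_j} = 0. If ∂g/∂w(0) were 0,
then dg would vanish at 0, as g vanishes on w = 0, and dT would not be invertible. -/
theorem isSegreMap (hq : ∀ j, q j ≠ 0) (hT : IsLocalAut (pseudoEllipsoid q) T) :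
    IsSegreMap q (fun x j => (T x).1 j ^ q j) (fun x => (T x).2) := by
  obtain ⟨G, hG, hGT, hTG⟩ := hT.exists_inverse_isLocalAut
  have hsnd : HasFDerivAt (fun x => (T x).2)
      ((ContinuousLinearMap.snd ℂ (Fin N → ℂ) ℂ).comp (fderiv ℂ T 0)) 0 :=
    (ContinuousLinearMap.snd ℂ (Fin N → ℂ) ℂ).hasFDerivAt.comp 0
      hT.analyticAt.differentiableAt.hasFDerivAt
  refine ⟨hq, fun j => (hT.analyticAt.coord j).pow _,
    ((ContinuousLinearMap.snd ℂ (Fin N → ℂ) ℂ).analyticAt _).comp hT.analyticAt, ?_, ?_,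
    segre_relation hq hT.analyticAt (hT.mem_iff.mono fun x hx => hx.2), ?_, ?_, ?_⟩
  · ext j
    simp [hT.map_zero, hq]
  · simp [hT.map_zero]
  · intro c hc
    have ht : Tendsto (fun u : Fin N → ℂ => ((u, 0) : CSpace N)) (𝓝 0) (𝓝 0) :=
      tendsto_id.prodMk_nhds tendsto_const_nhds
    have ht' : Tendsto (fun u : Fin N → ℂ => (G (u, 0)).1) (𝓝 0) (𝓝 0) :=
      (continuous_fst.tendsto (0 : CSpace N)).comp (hG.tendsto.comp ht)
    have h1 : ∀ᶠ u : Fin N → ℂ in 𝓝 0, ∑ j, c j * u j ^ q j = 0 := by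
      filter_upwards [ht'.eventually hc, ht.eventually (hG.eventually_snd_eq_zero hq),
        ht.eventually hTG] with u h1 h2 h3
      have h4 : ((G (u, 0)).1, (0 : ℂ)) = G (u, 0) := Prod.ext rfl (h2 rfl).symm
      simpa only [h4, h3] using h1
    ext k
    have h2 := ((tendsto_single k).mono_left (nhdsWithin_le_nhds (s := {0}ᶜ))).eventually h1
    obtain ⟨t, ht, ht0⟩ := (h2.and self_mem_nhdsWithin).exists
    simp only [single_pow hq, mul_ite, mul_zero, Finset.sum_ite_eq', Finset.mem_univ,
      if_true] at ht
    exact (mul_eq_zero.1 ht).resolve_right (pow_ne_zero _ ht0)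
  · filter_upwards [hT.tendsto.eventually (hG.eventually_snd_eq_zero hq), hGT] with x h1 h2 h3
    rw [← h2]
    exact h1 h3
  · intro h0
    have h1 : ∀ v : Fin N → ℂ, fderiv ℂ (fun x => (T x).2) 0 (v, 0) = 0 := by
      intro v
      have h2 : HasDerivAt (fun s : ℂ => (T (s • ((v, 0) : CSpace N))).2)
          (fderiv ℂ (fun x => (T x).2) 0 (v, 0)) 0 := by
        have h3 : HasDerivAt (fun s : ℂ => s • ((v, 0) : CSpace N)) ((v, 0) : CSpace N) 0 := by
          simpa using (hasDerivAt_id (0 : ℂ)).smul_const ((v, 0) : CSpace N)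
        rw [hsnd.fderiv]
        have h4 : HasFDerivAt (fun x => (T x).2)
            ((ContinuousLinearMap.snd ℂ (Fin N → ℂ) ℂ).comp (fderiv ℂ T 0))
            ((0 : ℂ) • ((v, 0) : CSpace N)) := by simpa using hsnd
        exact h4.comp_hasDerivAt (f := fun s : ℂ => s • ((v, 0) : CSpace N)) 0 h3
      have ht : Tendsto (fun s : ℂ => s • ((v, 0) : CSpace N)) (𝓝 0) (𝓝 0) := by
        have : Continuous (fun s : ℂ => s • ((v, 0) : CSpace N)) := by fun_prop
        simpa using this.tendsto 0
      refine h2.unique ((hasDerivAt_const (0 : ℂ) (0 : ℂ)).congr_of_eventuallyEq ?_)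
      filter_upwards [ht.eventually (hT.eventually_snd_eq_zero hq)] with s hs
      exact hs (by simp)
    have h2 := fderiv_comp_eq hG.analyticAt hG.map_zero hT.analyticAt hTG (0, 1)
    have h3 := congrArg Prod.snd h2
    set y := fderiv ℂ G 0 (0, 1)
    have h4 : fderiv ℂ (fun x => (T x).2) 0 y = 0 := by
      have : y = (y.1, 0) + y.2 • ((0, 1) : CSpace N) := by ext <;> simp
      rw [this, map_add, map_smul, h1, h0]
      simp
    rw [hsnd.fderiv] at h4
    simp only [ContinuousLinearMap.comp_apply, ContinuousLinearMap.coe_snd'] at h4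
    rw [h4] at h3
    exact zero_ne_one h3

end IsLocalAut

/-! ### Components with exponent at least two -/

/-- If the hyperplane `u_j = 0` is mapped into `u_k = 0`, then so it is by the derivative. -/
theorem fderiv_coord_eq_zero {N : ℕ} {G : CSpace N → CSpace N} (hG : AnalyticAt ℂ G 0) {j k : Fin N}
    (h : ∀ᶠ u in 𝓝 0, u.1 j = 0 → (G u).1 k = 0) {v : CSpace N} (hv : v.1 j = 0) :
    (fderiv ℂ G 0 v).1 k = 0 := by
  have h1 : HasDerivAt (fun s : ℂ => (G (s • v)).1 k) ((fderiv ℂ G 0 v).1 k) 0 := by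
    have h3 : HasDerivAt (fun s : ℂ => s • v) v 0 := by
      simpa using (hasDerivAt_id (0 : ℂ)).smul_const v
    have h4 : HasFDerivAt (fun x => (G x).1 k) ((coordCLM k).comp (fderiv ℂ G 0))
        ((0 : ℂ) • v) := by
      rw [zero_smul]
      exact (coordCLM k).hasFDerivAt.comp 0 hG.differentiableAt.hasFDerivAt
    exact h4.comp_hasDerivAt 0 h3
  have ht : Tendsto (fun s : ℂ => s • v) (𝓝 0) (𝓝 0) := by
    have : Continuous (fun s : ℂ => s • v) := by fun_prop
    simpa using this.tendsto 0
  refine h1.unique ((hasDerivAt_const (0 : ℂ) (0 : ℂ)).congr_of_eventuallyEq ?_)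
  filter_upwards [ht.eventually h] with s hs
  exact hs (by simp [hv])

/-- An analytic germ `f` with `f ^ n = c * h ^ n` is a constant multiple of `h`. -/
theorem exists_eq_mul_of_pow_eq {N : ℕ} {f h : CSpace N → ℂ} (hf : AnalyticAt ℂ f 0)
    (hh : AnalyticAt ℂ h 0) {n : ℕ} (hn : n ≠ 0) {c : ℂ} (hc : ∀ᶠ x in 𝓝 0, f x ^ n = c * h x ^ n)
    (hne : ∃ᶠ x in 𝓝 0, h x ≠ 0) : ∃ ω : ℂ, ω ^ n = c ∧ ∀ᶠ x in 𝓝 0, f x = ω * h x := by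
  obtain ⟨ε, hε, hb⟩ := Metric.eventually_nhds_iff_ball.1
    (hc.and (hf.eventually_analyticAt.and hh.eventually_analyticAt))
  obtain ⟨x₀, hx₀, hx₀b⟩ := (hne.and_eventually (Metric.ball_mem_nhds 0 hε)).exists
  refine ⟨f x₀ / h x₀, ?_, ?_⟩
  · rw [div_pow, (hb x₀ hx₀b).1, mul_div_cancel_right₀ _ (pow_ne_zero _ hx₀)]
  -- Where h ≠ 0 the continuous quotient f / h takes values in the finite set of n-th roots of `c`,
  -- so it is constant near x₀; the identity theorem extends this to the ball.
  · have hfin : {ζ : ℂ | ζ ^ n = c}.Finite := by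
      refine (Polynomial.nthRoots n c).toFinset.finite_toSet.subset fun ζ hζ => ?_
      simpa [Polynomial.mem_nthRoots (Nat.pos_of_ne_zero hn)] using hζ
    have hcd : ContinuousAt (fun x => f x / h x) x₀ :=
      (hb x₀ hx₀b).2.1.continuousAt.div (hb x₀ hx₀b).2.2.continuousAt hx₀
    have hne' : ∀ᶠ x in 𝓝 x₀, ∀ ζ ∈ {ζ : ℂ | ζ ^ n = c}, ζ ≠ f x₀ / h x₀ → f x / h x ≠ ζ :=
      hfin.eventually_all.2 fun ζ _ => by
        by_cases hζ : ζ = f x₀ / h x₀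
        · simp [hζ]
        · exact (hcd.eventually_ne (Ne.symm hζ)).mono fun x hx _ => hx
    have hloc : f =ᶠ[𝓝 x₀] fun x => f x₀ / h x₀ * h x := by
      filter_upwards [hne', Metric.isOpen_ball.mem_nhds hx₀b,
        (hb x₀ hx₀b).2.2.continuousAt.eventually_ne hx₀] with x h1 h2 h3
      have h4 : f x / h x = f x₀ / h x₀ := by
        by_contra h5
        refine h1 (f x / h x) ?_ h5 rfl
        rw [div_pow, (hb x h2).1, mul_div_cancel_right₀ _ (pow_ne_zero _ h3)]
      rw [← h4, div_mul_cancel₀ _ h3]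
    have := AnalyticOnNhd.eqOn_of_preconnected_of_eventuallyEq (U := Metric.ball 0 ε)
      (fun x hx => (hb x hx).2.1) (fun x hx => analyticAt_const.mul (hb x hx).2.2)
      (convex_ball _ _).isPreconnected hx₀b hloc
    filter_upwards [Metric.ball_mem_nhds 0 hε] with x hx
    exact this hx

/-- Comparison of orders at 0: as a ≠ 0, the left side of the equation has order exactly n, and the
right side has order m. -/
theorem eq_of_tendsto_pow {f : ℂ → ℂ} {a c : ℂ} (ha : a ≠ 0) {m n : ℕ}
    (hf : Tendsto f (𝓝[≠] 0) (𝓝 a)) (h : ∀ᶠ s in 𝓝[≠] (0 : ℂ), f s * s ^ n = c * s ^ m) (hc : c ≠ 0) :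
    m = n := by
  have h0 : ∀ {k : ℕ}, k ≠ 0 → Tendsto (fun s : ℂ => s ^ k) (𝓝[≠] 0) (𝓝 0) := fun {k} hk => by
    simpa [hk] using ((continuous_pow k).tendsto (0 : ℂ)).mono_left nhdsWithin_le_nhds
  rcases lt_trichotomy m n with hmn | rfl | hmn
  · exfalso
    have h1 : Tendsto (fun s => f s * s ^ (n - m)) (𝓝[≠] 0) (𝓝 (a * 0)) :=
      hf.mul (h0 (Nat.sub_ne_zero_of_lt hmn))
    have h2 : Tendsto (fun s => f s * s ^ (n - m)) (𝓝[≠] 0) (𝓝 c) := by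
      refine tendsto_const_nhds.congr' ?_
      filter_upwards [h, self_mem_nhdsWithin] with s hs hs0
      refine mul_right_cancel₀ (pow_ne_zero m hs0) ?_
      rw [mul_assoc, ← pow_add, Nat.sub_add_cancel hmn.le, hs]
    exact hc (by simpa using tendsto_nhds_unique h2 h1)
  · rfl
  · exfalso
    have h1 : Tendsto (fun s : ℂ => c * s ^ (m - n)) (𝓝[≠] 0) (𝓝 (c * 0)) :=
      (h0 (Nat.sub_ne_zero_of_lt hmn)).const_mul c
    have h2 : Tendsto f (𝓝[≠] 0) (𝓝 (c * 0)) := by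
      refine h1.congr' ?_
      filter_upwards [h, self_mem_nhdsWithin] with s hs hs0
      refine mul_right_cancel₀ (pow_ne_zero n hs0) ?_
      rw [mul_assoc, ← pow_add, Nat.sub_add_cancel hmn.le, hs]
    exact ha (by simpa using tendsto_nhds_unique hf h2)

/-- A component of a local automorphism whose power is fractional linear in `(z_k ^ q_k, w)` depends,
up to the denominator, on a single coordinate. -/
theorem IsLocalAut.exists_single_coord {N : ℕ} {q : Fin N → ℕ} (hq : ∀ j, q j ≠ 0)
    {T : CSpace N → CSpace N} (hT : IsLocalAut (pseudoEllipsoid q) T) {t : ℝ} (ht : 0 < t)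
    {b : Fin N → ℂ} {r : ℝ} {j : Fin N} (hj : 2 ≤ q j) {c : Fin N → ℂ} (hc : c ≠ 0)
    (hTj : ∀ᶠ x in 𝓝 0, (T x).1 j ^ q j =
      t * (∑ k, (x.1 k ^ q k + b k * x.2) * c k) / deltaFun q b r x) :
    ∃ k, q k = q j ∧ c k ≠ 0 ∧ (∀ k', k' ≠ k → c k' = 0) ∧ b k = 0 := by
  obtain ⟨G, hG, hGT, hTG⟩ := hT.exists_inverse_isLocalAut
  have htc : (t : ℂ) ≠ 0 := by exact_mod_cast ht.ne'
  let L : CSpace N → ℂ := fun x => ∑ k, (x.1 k ^ q k + b k * x.2) * c k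
  have hL : ∀ᶠ x in 𝓝 0, L x = (t : ℂ)⁻¹ * (deltaFun q b r x * (T x).1 j ^ q j) := by
    filter_upwards [hTj, eventually_deltaFun_ne_zero hq b r] with x h1 h2
    rw [h1]
    field_simp
    rfl
  -- Since q_j ≥ 2, the derivative of δ T_j^{q_j} vanishes wherever T_j does, so the same holds for
  -- `L`. The two conclusions are the components of dL in the directions z_k and w.
  have hderiv : ∀ᶠ x in 𝓝 0, (T x).1 j = 0 →
      (∀ k, x.1 k ^ (q k - 1) * c k = 0) ∧ ∑ k, b k * c k = 0 := by
    filter_upwards [hL.eventually_nhds, hT.analyticAt.eventually_analyticAt] with x h1 h2 h3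
    have h4 : HasFDerivAt (fun x => (t : ℂ)⁻¹ * (deltaFun q b r x * (T x).1 j ^ q j))
        (0 : CSpace N →L[ℂ] ℂ) x := by
      have h5 := ((h2.coord j).differentiableAt.hasFDerivAt).pow (q j)
      have h6 := ((analyticAt_deltaFun q b r x).differentiableAt.hasFDerivAt.mul h5).const_mul
        (t : ℂ)⁻¹
      have hq1 : q j - 1 ≠ 0 := by omega
      refine h6.congr_fderiv (ContinuousLinearMap.ext fun v => ?_)
      simp only [h3, zero_pow hq1, zero_pow (hq j), smul_zero, add_apply, smul_apply, zero_smul,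
        add_zero, zero_apply]
    have h5 : HasFDerivAt L (∑ k, c k • (((q k : ℂ) * x.1 k ^ (q k - 1)) • coordCLM k +
        b k • ContinuousLinearMap.snd ℂ (Fin N → ℂ) ℂ)) x := by
      refine HasFDerivAt.fun_sum fun k _ => ?_
      have h6 : HasFDerivAt (fun x : CSpace N => x.1 k ^ q k)
          (((q k : ℂ) * x.1 k ^ (q k - 1)) • coordCLM k) x := by
        simpa using ((coordCLM k).hasFDerivAt (x := x)).pow (q k)
      exact (h6.add ((ContinuousLinearMap.snd ℂ (Fin N → ℂ) ℂ).hasFDerivAt.const_mul (b k))).mul_const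
        (c k)
    have h6 := h5.unique (h4.congr_of_eventuallyEq h1)
    refine ⟨fun k => ?_, ?_⟩
    · have h7 := congrArg (fun L => L ((Pi.single k 1, 0) : CSpace N)) h6
      simp [Pi.single_apply, hq] at h7
      rcases h7 with h7 | h7 <;> simp [h7]
    · have h7 := congrArg (fun L => L ((0, 1) : CSpace N)) h6
      simpa [sum_apply, mul_comm] using h7
  obtain ⟨h0, hbc⟩ := hderiv.self_of_nhds (by simp [hT.map_zero])
  -- At the origin `hderiv` forces q_k ≥ 2 when c_k ≠ 0, and then {T_j = 0} lies in {z_k = 0}.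
  -- Through `G`: the hyperplane u_j = 0 is mapped into z_k = 0.
  have hvan : ∀ k, c k ≠ 0 → ∀ v : CSpace N, v.1 j = 0 → (fderiv ℂ G 0 v).1 k = 0 := by
    intro k hck v hv
    have hqk : q k - 1 ≠ 0 := by
      intro h1
      have := h0 k
      rw [h1] at this
      exact hck (by simpa using this)
    refine fderiv_coord_eq_zero hG.analyticAt ?_ hv
    filter_upwards [hG.tendsto.eventually hderiv, hTG] with u h1 h2 h3
    rw [h2] at h1
    exact (pow_eq_zero_iff hqk).1 ((mul_eq_zero.1 ((h1 h3).1 k)).resolve_right hck)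
  have hinv := IsLocalAut.fderiv_comp_eq hT.analyticAt hT.map_zero hG.analyticAt hGT
  have hne : ∀ k, c k ≠ 0 → (fderiv ℂ T 0 (Pi.single k 1, 0)).1 j ≠ 0 := by
    intro k hck h1
    have h2 := hvan k hck _ h1
    rw [hinv] at h2
    simp at h2
  obtain ⟨k, hck⟩ : ∃ k, c k ≠ 0 := by
    by_contra! h
    exact hc (funext h)
  -- Combine the images `a`, `a'` of e_k, e_k' under dT so that the j-th coordinate cancels. dG
  -- sends the combination back to a'_j e_k - a_j e_k', so `hvan` forces a'_j = 0, against `hne`.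
  have huniq : ∀ k', k' ≠ k → c k' = 0 := by
    intro k' hk
    by_contra hck'
    set a := fderiv ℂ T 0 (Pi.single k 1, 0) with ha
    set a' := fderiv ℂ T 0 (Pi.single k' 1, 0) with ha'
    have h1 := hvan k hck (a'.1 j • a - a.1 j • a') (by simp [mul_comm])
    rw [map_sub, map_smul, map_smul, ha, ha', hinv, hinv] at h1
    have h2 := hne k' hck'
    rw [← ha'] at h2
    simp [hk.symm] at h1
    exact h2 h1
  have hbk : b k = 0 := by
    rw [Finset.sum_eq_single k (fun k' _ hk => by rw [huniq k' hk, mul_zero]) (by simp)] at hbc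
    exact (mul_eq_zero.1 hbc).resolve_right hck
  -- For q_k = q_j, restrict to the k-th axis: T_j vanishes there to first order, so T_j^{q_j} has
  -- order q_j, whereas `L` equals c_k s^{q_k}.
  refine ⟨k, ?_, hck, huniq, hbk⟩
  have hline : Tendsto (fun s : ℂ => ((Pi.single k s, 0) : CSpace N)) (𝓝[≠] 0) (𝓝 0) :=
    ((tendsto_single k).prodMk_nhds tendsto_const_nhds).mono_left nhdsWithin_le_nhds
  have hder : Tendsto (fun s : ℂ => (T (Pi.single k s, 0)).1 j / s) (𝓝[≠] 0)
      (𝓝 ((fderiv ℂ T 0 (Pi.single k 1, 0)).1 j)) := by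
    have h3 : HasDerivAt (fun s : ℂ => s • ((Pi.single k 1, 0) : CSpace N)) (Pi.single k 1, 0) 0 := by
      simpa using (hasDerivAt_id (0 : ℂ)).smul_const ((Pi.single k 1, 0) : CSpace N)
    have h4 : HasFDerivAt (fun x => (T x).1 j) ((coordCLM j).comp (fderiv ℂ T 0))
        ((0 : ℂ) • ((Pi.single k 1, 0) : CSpace N)) := by
      rw [zero_smul]
      exact (coordCLM j).hasFDerivAt.comp 0 hT.analyticAt.differentiableAt.hasFDerivAt
    have h5 := (h4.comp_hasDerivAt 0 h3).tendsto_slope_zero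
    refine h5.congr fun s => ?_
    have : s • ((Pi.single k 1, 0) : CSpace N) = (Pi.single k s, 0) := by
      ext i <;> simp [Pi.single_apply]
    simp only [zero_add, Function.comp, this, zero_smul, hT.map_zero, smul_eq_mul]
    simp [div_eq_inv_mul]
  have hδ : Tendsto (fun s : ℂ => deltaFun q b r (Pi.single k s, 0)) (𝓝[≠] 0) (𝓝 1) := by
    have := (analyticAt_deltaFun q b r 0).continuousAt.tendsto.comp hline
    rwa [deltaFun_zero hq] at this
  refine eq_of_tendsto_pow (pow_ne_zero (q j) (hne k hck)) (c := t * c k)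
    (by simpa using (hder.pow (q j)).mul hδ) ?_ (mul_ne_zero htc hck)
  filter_upwards [hline.eventually hL, self_mem_nhdsWithin] with s hs hs0
  have hs0' : s ≠ 0 := hs0
  have h1 : L (Pi.single k s, 0) = s ^ q k * c k := by
    simp [L, single_pow hq]
  rw [h1] at hs
  rw [div_pow]
  field_simp
  field_simp at hs
  linear_combination -hs

/-! ### Decomposition of local automorphisms -/

theorem sum_castLE_of_eq_zero {R : Type*} [AddCommMonoid R] {N s : ℕ} (hs : s ≤ N) {f : Fin N → R}
    (hf : ∀ k, s ≤ k.val → f k = 0) : ∑ k, f k = ∑ i : Fin s, f (Fin.castLE hs i) := by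
  refine (Fintype.sum_of_injective (Fin.castLE hs) (Fin.castLE_injective hs) _ _ (fun k hk => ?_)
    fun i => rfl).symm
  refine hf k (not_lt.1 fun hks => hk ⟨⟨k, hks⟩, ?_⟩)
  ext
  simp

/-- `b` is supported on the coordinates that σ fixes. -/
theorem deltaFun_coordPerm {N s : ℕ} {q : Fin N → ℕ} {σ : Equiv.Perm (Fin N)}
    (hσ : σ ∈ admissiblePerms s q) {b : Fin N → ℂ} (hb : ∀ j, s ≤ j.val → b j = 0) (r : ℝ)
    (x : CSpace N) : deltaFun q b r (coordPerm σ x) = deltaFun q b r x := by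
  have : ∀ j, (coordPerm σ x).1 j ^ q j * conj (b j) = x.1 j ^ q j * conj (b j) := by
    intro j
    by_cases hj : j.val < s
    · simp [coordPerm, hσ.1 j hj]
    · simp [hb j (not_lt.1 hj)]
  simp only [deltaFun, this]
  rfl

/-- In a unitary matrix the only nonzero entry of a column has modulus one, so it is also the only
one in its row; hence distinct columns use distinct rows. Equality of exponents keeps the indices ≥
s among themselves, so the identity on the others extends the map to a permutation. -/
theorem exists_perm_of_columns {N s : ℕ} {q : Fin N → ℕ} (hq_two : ∀ j, s ≤ j.val → 2 ≤ q j)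
    (hq_one : ∀ j, j.val < s → q j = 1)
    {U : Matrix (Fin N) (Fin N) ℂ} (hU : U ∈ Matrix.unitaryGroup (Fin N) ℂ)
    (h : ∀ j : Fin N, s ≤ j.val → ∃ k, q k = q j ∧ U k j ≠ 0 ∧ ∀ k', k' ≠ k → U k' j = 0) :
    ∃ σ ∈ admissiblePerms s q, ∀ j : Fin N, s ≤ j.val → ‖U (σ j) j‖ = 1 ∧
      (∀ k, k ≠ σ j → U k j = 0) ∧ ∀ i, i ≠ j → U (σ j) i = 0 := by
  choose! κ hκq hκ0 hκ using h
  have hcol : ∀ j : Fin N, s ≤ j.val → ‖U (κ j) j‖ = 1 := by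
    intro j hj
    have h1 := congrFun (congrFun (Matrix.mem_unitaryGroup_iff'.1 hU) j) j
    rw [Matrix.mul_apply, Finset.sum_eq_single (κ j) (fun k _ hk => by rw [hκ j hj k hk, mul_zero])
      (by simp), Matrix.star_apply, RCLike.star_def, Matrix.one_apply_eq, Complex.conj_mul'] at h1
    have h2 : ‖U (κ j) j‖ ^ 2 = 1 := by exact_mod_cast h1
    exact (pow_eq_one_iff_of_nonneg (norm_nonneg _) two_ne_zero).1 h2
  have hrow : ∀ j : Fin N, s ≤ j.val → ∀ i, i ≠ j → U (κ j) i = 0 := by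
    intro j hj i hi
    have h1 := congrFun (congrFun (Matrix.mem_unitaryGroup_iff.1 hU) (κ j)) (κ j)
    simp only [Matrix.mul_apply, Matrix.star_apply, RCLike.star_def, Matrix.one_apply_eq,
      Complex.mul_conj'] at h1
    have h2 : ∑ i, ‖U (κ j) i‖ ^ 2 = 1 := by exact_mod_cast h1
    rw [← Finset.add_sum_erase _ _ (Finset.mem_univ j), hcol j hj, one_pow, add_eq_left] at h2
    have h3 := (Finset.sum_eq_zero_iff_of_nonneg (fun _ _ => by positivity)).1 h2 i
      (Finset.mem_erase.2 ⟨hi, Finset.mem_univ _⟩)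
    simpa using h3
  have hκs : ∀ j : Fin N, s ≤ j.val → s ≤ (κ j).val := by
    intro j hj
    by_contra hlt
    have h1 := hq_one (κ j) (not_le.1 hlt)
    have h2 := hq_two j hj
    have h3 := hκq j hj
    omega
  let f : Fin N → Fin N := fun j => if j.val < s then j else κ j
  have hf1 : ∀ j : Fin N, j.val < s → f j = j := fun j hj => if_pos hj
  have hf2 : ∀ j : Fin N, s ≤ j.val → f j = κ j := fun j hj => if_neg (not_lt.2 hj)
  have hinj : Function.Injective f := by
    intro i j hij
    rcases lt_or_ge i.val s with hi | hi <;> rcases lt_or_ge j.val s with hj | hj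
    · rwa [hf1 i hi, hf1 j hj] at hij
    · rw [hf1 i hi, hf2 j hj] at hij
      have := hκs j hj
      rw [← hij] at this
      omega
    · rw [hf2 i hi, hf1 j hj] at hij
      have := hκs i hi
      rw [hij] at this
      omega
    · rw [hf2 i hi, hf2 j hj] at hij
      by_contra hne
      exact hκ0 i hi (hij ▸ hrow j hj i hne)
  let σ : Equiv.Perm (Fin N) := Equiv.ofBijective f (Finite.injective_iff_bijective.1 hinj)
  have hσ2 : ∀ j : Fin N, s ≤ j.val → σ j = κ j := hf2
  refine ⟨σ, ⟨hf1, fun j => ?_⟩, fun j hj => ?_⟩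
  · rcases lt_or_ge j.val s with hj | hj
    · exact congrArg q (hf1 j hj)
    · rw [hσ2 j hj, hκq j hj]
  · rw [hσ2 j hj]
    exact ⟨hcol j hj, hκ j hj, hrow j hj⟩

/-- Local automorphisms decompose into elementary maps. -/
theorem IsLocalAut.exists_decomposition {N s : ℕ} (hN : 1 ≤ N) (hs : s ≤ N) {q : Fin N → ℕ}
    (hq_one : ∀ j, j.val < s → q j = 1) (hq_two : ∀ j, s ≤ j.val → 2 ≤ q j)
    {T : CSpace N → CSpace N} (hT : IsLocalAut (pseudoEllipsoid q) T) :
    ∃ σ ∈ admissiblePerms s q, ∃ (t : ℝ) (U : Matrix (Fin s) (Fin s) ℂ) (θ : Fin N → ℝ)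
      (b : Fin N → ℂ) (r : ℝ), 0 < t ∧ U ∈ Matrix.unitaryGroup (Fin s) ℂ ∧
      (∀ j, s ≤ j.val → b j = 0) ∧
      T =ᶠ[𝓝 0] dilation q t ∘ blockRotation hs U θ ∘ fractional s q b r ∘ coordPerm σ := by
  have hq : ∀ j, q j ≠ 0 := by
    intro j
    rcases lt_or_ge j.val s with hj | hj
    · rw [hq_one j hj]
      exact one_ne_zero
    · have := hq_two j hj
      omega
  obtain ⟨t, U, b, r, ht, hU, hTf⟩ := (hT.isSegreMap hq).exists_fractional_form hN
  have hcol : ∀ j, (fun k => U k j) ≠ 0 := by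
    intro j h0
    have h1 := congrFun (congrFun (Matrix.mem_unitaryGroup_iff'.1 hU) j) j
    have h2 : ∀ k, U k j = 0 := fun k => congrFun h0 k
    simp [Matrix.mul_apply, h2] at h1
  have hsingle := fun (j : Fin N) (hj : s ≤ j.val) =>
    hT.exists_single_coord hq ht (hq_two j hj) (hcol j) (hTf.mono fun x hx => hx.1 j)
  obtain ⟨σ, hσ, hUσ⟩ := exists_perm_of_columns hq_two hq_one hU fun j hj => by
    obtain ⟨k, h1, h2, h3, -⟩ := hsingle j hj
    exact ⟨k, h1, h2, h3⟩
  have hσs : ∀ j : Fin N, s ≤ j.val → s ≤ (σ j).val := by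
    intro j hj
    by_contra hlt
    have h1 := hq_one (σ j) (not_le.1 hlt)
    have h2 := hq_two j hj
    have h3 := hσ.2 j
    omega
  have hσs' : ∀ k : Fin N, s ≤ k.val → ∃ j : Fin N, s ≤ j.val ∧ σ j = k := by
    intro k hk
    refine ⟨σ.symm k, ?_, σ.apply_symm_apply k⟩
    by_contra hlt
    have h1 := hσ.1 _ (not_le.1 hlt)
    rw [σ.apply_symm_apply] at h1
    rw [← h1] at hlt
    exact hlt hk
  have hb : ∀ k : Fin N, s ≤ k.val → b k = 0 := by
    intro k hk
    obtain ⟨j, hj, rfl⟩ := hσs' k hk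
    obtain ⟨k', h1, h2, h3, h4⟩ := hsingle j hj
    have : k' = σ j := by
      by_contra hne
      exact h2 ((hUσ j hj).2.1 k' hne)
    rwa [← this]
  -- A row of index k ≥ s has its only nonzero entry in a column of index ≥ s. This also makes the
  -- upper left block unitary.
  have hU0 : ∀ k : Fin N, s ≤ k.val → ∀ j : Fin N, j.val < s → U k j = 0 := by
    intro k hk j hj
    obtain ⟨i, hi, rfl⟩ := hσs' k hk
    exact (hUσ i hi).2.2 j (by rintro rfl; omega)
  have hTσ : ∀ j : Fin N, s ≤ j.val → ∀ᶠ x in 𝓝 0, (T x).1 j ^ q j =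
      U (σ j) j * (((t ^ (1 / (q j : ℝ)) : ℝ) : ℂ) *
        (x.1 (σ j) / deltaFun q b r x ^ (1 / (q j : ℂ)))) ^ q j := by
    intro j hj
    filter_upwards [hTf] with x hx
    have h1 : ((t ^ (1 / (q j : ℝ)) : ℝ) : ℂ) ^ q j = t := by
      rw [← Complex.ofReal_pow, one_div, Real.rpow_inv_natCast_pow ht.le (hq j)]
    have h2 : (deltaFun q b r x ^ (1 / (q j : ℂ))) ^ q j = deltaFun q b r x := by
      rw [one_div, Complex.cpow_nat_inv_pow _ (hq j)]
    rw [hx.1 j, Finset.sum_eq_single (σ j)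
      (fun k _ hk => by rw [(hUσ j hj).2.1 k hk, mul_zero]) (by simp), hb _ (hσs j hj), zero_mul,
      add_zero, mul_pow, div_pow, h1, h2, hσ.2 j]
    ring
  -- By `hTσ` the q_j-th powers of both sides differ by a constant of modulus one, so the functions
  -- differ by a q_j-th root of it.
  have hroot : ∀ j : Fin N, s ≤ j.val → ∃ θ : ℝ, ∀ᶠ x in 𝓝 0, (T x).1 j =
      Complex.exp (Complex.I * θ) * (((t ^ (1 / (q j : ℝ)) : ℝ) : ℂ) *
        (x.1 (σ j) / deltaFun q b r x ^ (1 / (q j : ℂ)))) := by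
    intro j hj
    have hδ0 : deltaFun q b r (0 : CSpace N) = 1 := deltaFun_zero hq b r
    have hpow : AnalyticAt ℂ (fun x => deltaFun q b r x ^ (1 / (q j : ℂ))) 0 :=
      (analyticAt_deltaFun q b r 0).cpow analyticAt_const (by simp [hδ0])
    have hh : AnalyticAt ℂ (fun x : CSpace N => ((t ^ (1 / (q j : ℝ)) : ℝ) : ℂ) *
        (x.1 (σ j) / deltaFun q b r x ^ (1 / (q j : ℂ)))) 0 :=
      analyticAt_const.mul (((coordCLM (σ j)).analyticAt _).div hpow (by simp [hδ0]))
    have hline : Tendsto (fun s : ℂ => ((Pi.single (σ j) s, 0) : CSpace N)) (𝓝[≠] 0) (𝓝 0) :=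
      ((tendsto_single (σ j)).prodMk_nhds tendsto_const_nhds).mono_left nhdsWithin_le_nhds
    obtain ⟨ω, hω, hTω⟩ := exists_eq_mul_of_pow_eq (hT.analyticAt.coord j) hh (hq j) (hTσ j hj) (by
      refine hline.frequently (Eventually.frequently ?_)
      filter_upwards [hline.eventually (eventually_deltaFun_ne_zero hq b r), self_mem_nhdsWithin]
        with s hs hs0
      have ht' : ((t ^ (1 / (q j : ℝ)) : ℝ) : ℂ) ≠ 0 := by
        exact_mod_cast (Real.rpow_pos_of_pos ht _).ne'
      refine mul_ne_zero ht' (div_ne_zero (by simpa using hs0) ?_)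
      rw [Complex.cpow_ne_zero_iff]
      exact Or.inl hs)
    have hω1 : ‖ω‖ = 1 := by
      have := congrArg norm hω
      rw [norm_pow, (hUσ j hj).1] at this
      exact (pow_eq_one_iff_of_nonneg (norm_nonneg _) (hq j)).1 this
    refine ⟨ω.arg, ?_⟩
    have : Complex.exp (Complex.I * ω.arg) = ω := by
      have := Complex.norm_mul_exp_arg_mul_I ω
      rwa [hω1, Complex.ofReal_one, one_mul, mul_comm] at this
    rw [this]
    exact hTω
  choose! θ hθ using hroot
  refine ⟨σ, hσ, t, U.submatrix (Fin.castLE hs) (Fin.castLE hs), θ, b, r, ht, ?_, hb, ?_⟩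
  · rw [Matrix.mem_unitaryGroup_iff']
    ext i j
    have h1 := congrFun (congrFun (Matrix.mem_unitaryGroup_iff'.1 hU) (Fin.castLE hs i))
      (Fin.castLE hs j)
    rw [Matrix.mul_apply, sum_castLE_of_eq_zero hs (fun k hk => by
      rw [hU0 k hk _ (by simp), mul_zero])] at h1
    simpa [Matrix.mul_apply, Matrix.one_apply] using h1
  · have hθ' : ∀ᶠ x in 𝓝 0, ∀ j : Fin N, s ≤ j.val → (T x).1 j =
        Complex.exp (Complex.I * θ j) * (((t ^ (1 / (q j : ℝ)) : ℝ) : ℂ) *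
        (x.1 (σ j) / deltaFun q b r x ^ (1 / (q j : ℂ)))) :=
      eventually_all.2 fun j => by
        by_cases hj : s ≤ j.val
        · exact (hθ j hj).mono fun x hx _ => hx
        · exact Eventually.of_forall fun x h => absurd h hj
    filter_upwards [hTf, hθ'] with x hx hxθ
    have hδσ := deltaFun_coordPerm hσ hb r x
    refine Prod.ext (funext fun j => ?_) ?_
    · simp only [Function.comp, dilation, blockRotation]
      split_ifs with hj
      · have h1 := hx.1 j
        rw [hq_one j hj, pow_one] at h1
        rw [h1, hq_one j hj, sum_castLE_of_eq_zero hs (fun k hk => by rw [hU0 k hk j hj, mul_zero])]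
        simp only [Matrix.vecMul, dotProduct, Matrix.submatrix_apply, fractional, Fin.val_castLE,
          Fin.is_lt, if_true, hδσ, Nat.cast_one, div_one, Real.rpow_one, Finset.mul_sum,
          Finset.sum_div]
        refine Finset.sum_congr rfl fun i _ => ?_
        have h2 : (coordPerm σ x).1 (Fin.castLE hs i) = x.1 (Fin.castLE hs i) := by
          simp [coordPerm, hσ.1 (Fin.castLE hs i) (by simp)]
        have h3 : (coordPerm σ x).2 = x.2 := rfl
        have h4 : (Fin.castLE hs ⟨j.val, hj⟩ : Fin N) = j := rfl
        rw [h2, h3, h4, hq_one (Fin.castLE hs i) (by simp), pow_one]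
        ring
      · rw [hxθ j (not_lt.1 hj)]
        simp only [fractional, hj, if_false, hδσ]
        have h2 : (coordPerm σ x).1 j = x.1 (σ j) := rfl
        rw [h2]
        ring
    · simp only [Function.comp, dilation, blockRotation, fractional, hδσ]
      rw [hx.2, mul_div_assoc]
      rfl

/-! ### The elementary maps are local automorphisms -/

theorem IsLocalAut.of_inverse {N : ℕ} {M : Set (CSpace N)} {f g : CSpace N → CSpace N}
    (hf : AnalyticAt ℂ f 0) (hg : AnalyticAt ℂ g 0) (h0 : f 0 = 0)
    (hgf : ∀ᶠ x in 𝓝 0, g (f x) = x) (hfg : ∀ᶠ x in 𝓝 0, f (g x) = x)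
    (hM : ∀ᶠ x in 𝓝 0, (f x ∈ M ↔ x ∈ M)) : IsLocalAut M f :=
  ⟨hf, h0, ⟨g, hg, hgf, hfg⟩, hM⟩

theorem AnalyticAt.cspace_mk {N : ℕ} {E : Type*} [NormedAddCommGroup E] [NormedSpace ℂ E]
    {u : E → Fin N → ℂ} {v : E → ℂ} {x : E} (hu : ∀ j, AnalyticAt ℂ (fun y => u y j) x)
    (hv : AnalyticAt ℂ v x) : AnalyticAt ℂ (fun y => ((u y, v y) : CSpace N)) x :=
  (analyticAt_pi_iff.2 hu).prod hv

theorem analyticAt_coord {N : ℕ} (j : Fin N) (x : CSpace N) :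
    AnalyticAt ℂ (fun y : CSpace N => y.1 j) x :=
  (coordCLM j).analyticAt x

/-! ### Dilations -/

theorem analyticAt_dilation {N : ℕ} (q : Fin N → ℕ) (t : ℝ) (x : CSpace N) :
    AnalyticAt ℂ (dilation q t) x :=
  AnalyticAt.cspace_mk (fun j => analyticAt_const.mul (analyticAt_coord j x))
    (analyticAt_const.mul analyticAt_snd)

theorem dilation_inv_dilation {N : ℕ} (q : Fin N → ℕ) {t : ℝ} (ht : 0 < t) (x : CSpace N) :
    dilation q t⁻¹ (dilation q t x) = x := by
  have htc : (t : ℂ) ≠ 0 := by exact_mod_cast ht.ne'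
  refine Prod.ext (funext fun j => ?_) ?_
  · have h1 : ((t ^ (1 / (q j : ℝ)) : ℝ) : ℂ) ≠ 0 := by
      exact_mod_cast (Real.rpow_pos_of_pos ht _).ne'
    simp only [dilation, Real.inv_rpow ht.le]
    push_cast
    rw [inv_mul_cancel_left₀ h1]
  · simp only [dilation]
    push_cast
    field_simp

theorem isLocalAut_dilation {N : ℕ} {q : Fin N → ℕ} (hq : ∀ j, q j ≠ 0) {t : ℝ} (ht : 0 < t) :
    IsLocalAut (pseudoEllipsoid q) (dilation q t) := by
  refine IsLocalAut.of_inverse (analyticAt_dilation q t 0) (analyticAt_dilation q t⁻¹ 0) ?_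
    (Eventually.of_forall fun x => dilation_inv_dilation q ht x)
    (Eventually.of_forall fun x => ?_) (Eventually.of_forall fun x => ?_)
  · ext <;> simp [dilation]
  · have := dilation_inv_dilation q (inv_pos.2 ht) x
    rwa [inv_inv] at this
  · have h1 : ((dilation q t x).2).im = t ^ 2 * x.2.im := by
      simp only [dilation]
      rw [← Complex.ofReal_pow, Complex.im_ofReal_mul]
    have h2 : ∀ j, ‖(dilation q t x).1 j ^ q j‖ ^ 2 = t ^ 2 * ‖x.1 j ^ q j‖ ^ 2 := by
      intro j
      simp only [dilation]
      rw [mul_pow, ← Complex.ofReal_pow, one_div, Real.rpow_inv_natCast_pow ht.le (hq j), norm_mul,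
        mul_pow, Complex.norm_real, Real.norm_of_nonneg ht.le]
    change (_ = _) ↔ (_ = _)
    simp only [h1, h2, ← Finset.mul_sum]
    exact mul_right_inj' (by positivity)

/-! ### Rotations -/

theorem analyticAt_blockRotation {N s : ℕ} (hs : s ≤ N) (U : Matrix (Fin s) (Fin s) ℂ)
    (θ : Fin N → ℝ) (x : CSpace N) : AnalyticAt ℂ (blockRotation hs U θ) x := by
  refine AnalyticAt.cspace_mk (fun j => ?_) analyticAt_snd
  by_cases hj : j.val < s
  · simp only [hj, dif_pos, Matrix.vecMul, dotProduct]
    exact Finset.analyticAt_fun_sum _ fun i _ => (analyticAt_coord _ x).mul analyticAt_const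
  · simp only [hj, dif_neg, not_false_eq_true]
    exact analyticAt_const.mul (analyticAt_coord j x)

theorem blockRotation_blockRotation {N s : ℕ} (hs : s ≤ N) {U V : Matrix (Fin s) (Fin s) ℂ}
    (hUV : U * V = 1) (θ : Fin N → ℝ) (x : CSpace N) :
    blockRotation hs V (-θ) (blockRotation hs U θ x) = x := by
  refine Prod.ext (funext fun j => ?_) rfl
  by_cases hj : j.val < s
  · have h1 : (fun i : Fin s => (blockRotation hs U θ x).1 (Fin.castLE hs i)) =
        Matrix.vecMul (fun i : Fin s => x.1 (Fin.castLE hs i)) U := by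
      ext i
      simp [blockRotation]
    have h2 : (blockRotation hs V (-θ) (blockRotation hs U θ x)).1 j =
        Matrix.vecMul (fun i : Fin s => (blockRotation hs U θ x).1 (Fin.castLE hs i)) V
          ⟨j.val, hj⟩ := dif_pos hj
    rw [h2, h1, Matrix.vecMul_vecMul, hUV, Matrix.vecMul_one]
    rfl
  · simp only [blockRotation, hj, dif_neg, not_false_eq_true, Pi.neg_apply, Complex.ofReal_neg,
      mul_neg, Complex.exp_neg]
    rw [inv_mul_cancel_left₀ (Complex.exp_ne_zero _)]

theorem sum_norm_sq_vecMul {n : ℕ} {U : Matrix (Fin n) (Fin n) ℂ}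
    (hU : U ∈ Matrix.unitaryGroup (Fin n) ℂ) (z : Fin n → ℂ) :
    ∑ i, ‖Matrix.vecMul z U i‖ ^ 2 = ∑ i, ‖z i‖ ^ 2 := by
  have h1 : dotProduct (Matrix.vecMul z U) (star (Matrix.vecMul z U)) = dotProduct z (star z) := by
    rw [Matrix.star_vecMul, Matrix.dotProduct_mulVec, Matrix.vecMul_vecMul,
      ← Matrix.star_eq_conjTranspose, Matrix.mem_unitaryGroup_iff.1 hU, Matrix.vecMul_one]
  simp only [dotProduct, Pi.star_apply, RCLike.star_def, Complex.mul_conj'] at h1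
  exact_mod_cast h1

theorem isLocalAut_blockRotation {N s : ℕ} (hs : s ≤ N) {q : Fin N → ℕ}
    (hq_one : ∀ j, j.val < s → q j = 1) {U : Matrix (Fin s) (Fin s) ℂ}
    (hU : U ∈ Matrix.unitaryGroup (Fin s) ℂ) (θ : Fin N → ℝ) :
    IsLocalAut (pseudoEllipsoid q) (blockRotation hs U θ) := by
  refine IsLocalAut.of_inverse (analyticAt_blockRotation hs U θ 0)
    (analyticAt_blockRotation hs (star U) (-θ) 0) ?_
    (Eventually.of_forall fun x =>
      blockRotation_blockRotation hs (Matrix.mem_unitaryGroup_iff.1 hU) θ x)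
    (Eventually.of_forall fun x => ?_) (Eventually.of_forall fun x => ?_)
  · have : (fun _ : Fin s => (0 : ℂ)) = 0 := rfl
    ext j <;> simp [blockRotation, this]
  · have := blockRotation_blockRotation hs (Matrix.mem_unitaryGroup_iff'.1 hU) (-θ) x
    rwa [neg_neg] at this
  · change (_ = _) ↔ (_ = _)
    have h1 : ∑ j, ‖(blockRotation hs U θ x).1 j ^ q j‖ ^ 2 = ∑ j, ‖x.1 j ^ q j‖ ^ 2 := by
      rw [← sub_eq_zero, ← Finset.sum_sub_distrib, sum_castLE_of_eq_zero hs]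
      · rw [Finset.sum_sub_distrib, sub_eq_zero]
        have h2 : ∀ i : Fin s, q (Fin.castLE hs i) = 1 := fun i => hq_one _ (by simp)
        simp only [h2, pow_one]
        rw [← sum_norm_sq_vecMul hU fun i => x.1 (Fin.castLE hs i)]
        refine Finset.sum_congr rfl fun i _ => ?_
        simp [blockRotation]
      · intro k hk
        have h3 : ‖Complex.exp (Complex.I * θ k)‖ = 1 := by
          rw [mul_comm, Complex.norm_exp_ofReal_mul_I]
        simp [blockRotation, not_lt.2 hk, mul_pow, h3]
    rw [h1]
    rfl

/-! ### Permutations -/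

theorem analyticAt_coordPerm {N : ℕ} (σ : Equiv.Perm (Fin N)) (x : CSpace N) :
    AnalyticAt ℂ (coordPerm σ) x :=
  AnalyticAt.cspace_mk (fun j => analyticAt_coord (σ j) x) analyticAt_snd

theorem isLocalAut_coordPerm {N : ℕ} {q : Fin N → ℕ} {σ : Equiv.Perm (Fin N)}
    (hσ : ∀ j, q (σ j) = q j) : IsLocalAut (pseudoEllipsoid q) (coordPerm σ) := by
  refine IsLocalAut.of_inverse (analyticAt_coordPerm σ 0) (analyticAt_coordPerm σ.symm 0) rfl
    (Eventually.of_forall fun x => ?_) (Eventually.of_forall fun x => ?_)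
    (Eventually.of_forall fun x => ?_)
  · ext j <;> simp [coordPerm]
  · ext j <;> simp [coordPerm]
  · change (_ = _) ↔ (_ = _)
    have h1 : ∑ j, ‖(coordPerm σ x).1 j ^ q j‖ ^ 2 = ∑ j, ‖x.1 j ^ q j‖ ^ 2 := by
      rw [← Equiv.sum_comp σ fun j => ‖x.1 j ^ q j‖ ^ 2]
      simp only [hσ]
      rfl
    rw [h1]
    rfl

/-! ### Fractional linear maps -/

theorem analyticAt_fractional {N : ℕ} (s : ℕ) {q : Fin N → ℕ} {b : Fin N → ℂ} {r : ℝ}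
    {x : CSpace N} (hx : deltaFun q b r x ∈ Complex.slitPlane) :
    AnalyticAt ℂ (fractional s q b r) x := by
  have hδ := analyticAt_deltaFun q b r x
  have hδ0 := Complex.slitPlane_ne_zero hx
  refine AnalyticAt.cspace_mk (fun j => ?_) (analyticAt_snd.div hδ hδ0)
  split_ifs with hj
  · exact ((analyticAt_coord j x).add (analyticAt_const.mul analyticAt_snd)).div hδ hδ0
  · exact (analyticAt_coord j x).div (hδ.cpow analyticAt_const hx)
      (by rw [Complex.cpow_ne_zero_iff]; exact Or.inl hδ0)

theorem eventually_deltaFun_mem_slitPlane {N : ℕ} {q : Fin N → ℕ} (hq : ∀ j, q j ≠ 0)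
    (b : Fin N → ℂ) (r : ℝ) : ∀ᶠ x in 𝓝 0, deltaFun q b r x ∈ Complex.slitPlane :=
  (analyticAt_deltaFun q b r 0).continuousAt.eventually_mem
    (Complex.isOpen_slitPlane.mem_nhds (by simp [deltaFun_zero hq]))

/-- One formula covers both cases, since q_j = 1 for j < s and b_j = 0 otherwise. In the powers
z_j^{q_j} the map is that of the quadric. -/
theorem fractional_pow {N s : ℕ} {q : Fin N → ℕ} (hq : ∀ j, q j ≠ 0)
    (hq_one : ∀ j, j.val < s → q j = 1) {b : Fin N → ℂ} (hb : ∀ j, s ≤ j.val → b j = 0) (r : ℝ)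
    (x : CSpace N) (j : Fin N) :
    (fractional s q b r x).1 j ^ q j = (x.1 j ^ q j + b j * x.2) / deltaFun q b r x := by
  simp only [fractional]
  split_ifs with hj
  · rw [hq_one j hj, pow_one, pow_one]
  · rw [div_pow, one_div, Complex.cpow_nat_inv_pow _ (hq j), hb j (not_lt.1 hj), zero_mul, add_zero]

/-- This cancellation of denominators is what makes Ψ_{-b,-r} the inverse of Ψ_{b,r}. -/
theorem deltaFun_fractional {N s : ℕ} {q : Fin N → ℕ} (hq : ∀ j, q j ≠ 0)
    (hq_one : ∀ j, j.val < s → q j = 1) {b : Fin N → ℂ} (hb : ∀ j, s ≤ j.val → b j = 0) (r : ℝ)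
    {x : CSpace N} (hx : deltaFun q b r x ≠ 0) :
    deltaFun q (-b) (-r) (fractional s q b r x) = (deltaFun q b r x)⁻¹ := by
  have h1 : ∑ j, (fractional s q b r x).1 j ^ q j * conj ((-b) j) =
      -(∑ j, x.1 j ^ q j * conj (b j) + (∑ j, b j * conj (b j)) * x.2) / deltaFun q b r x := by
    simp only [fractional_pow hq hq_one hb, Pi.neg_apply, map_neg, neg_div, Finset.sum_mul,
      ← Finset.sum_add_distrib, Finset.sum_div, ← Finset.sum_neg_distrib]
    refine Finset.sum_congr rfl fun j _ => ?_
    ring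
  have h2 : ∑ j, (-b) j * conj ((-b) j) = ∑ j, b j * conj (b j) := by simp
  have h3 : (fractional s q b r x).2 = x.2 / deltaFun q b r x := rfl
  have h4 : deltaFun q b r x = 1 - 2 * Complex.I * ∑ j, x.1 j ^ q j * conj (b j)
    - ((r : ℂ) + Complex.I * ∑ j, b j * conj (b j)) * x.2 := rfl
  refine eq_inv_of_mul_eq_one_left ?_
  rw [deltaFun, h1, h2, h3]
  push_cast
  field_simp
  rw [h4]
  ring

theorem fractional_neg_fractional {N s : ℕ} {q : Fin N → ℕ} (hq : ∀ j, q j ≠ 0)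
    (hq_one : ∀ j, j.val < s → q j = 1) {b : Fin N → ℂ} (hb : ∀ j, s ≤ j.val → b j = 0) (r : ℝ)
    {x : CSpace N} (hx : deltaFun q b r x ∈ Complex.slitPlane) :
    fractional s q (-b) (-r) (fractional s q b r x) = x := by
  have hx0 := Complex.slitPlane_ne_zero hx
  have hδ := deltaFun_fractional hq hq_one hb r hx0
  refine Prod.ext (funext fun j => ?_) ?_
  · simp only [fractional] at hδ ⊢
    rw [hδ]
    split_ifs with hj
    · simp only [Pi.neg_apply]
      field_simp
      ring
    -- Principal roots commute with inversion off the negative axis.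
    · rw [Complex.inv_cpow _ _ (Complex.slitPlane_arg_ne_pi hx)]
      have : deltaFun q b r x ^ (1 / (q j : ℂ)) ≠ 0 := by
        rw [Complex.cpow_ne_zero_iff]
        exact Or.inl hx0
      field_simp
  · change x.2 / deltaFun q b r x / deltaFun q (-b) (-r) (fractional s q b r x) = x.2
    rw [hδ]
    field_simp

/-- Ψ multiplies the defining function Im w - ∑ |z_j^{q_j}|² by 1 / |δ|²; `h3` is this identity with
the denominator cleared. -/
theorem fractional_mem_iff {N s : ℕ} {q : Fin N → ℕ} (hq : ∀ j, q j ≠ 0)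
    (hq_one : ∀ j, j.val < s → q j = 1) {b : Fin N → ℂ} (hb : ∀ j, s ≤ j.val → b j = 0) (r : ℝ)
    {x : CSpace N} (hx : deltaFun q b r x ≠ 0) :
    fractional s q b r x ∈ pseudoEllipsoid q ↔ x ∈ pseudoEllipsoid q := by
  set δ := deltaFun q b r x with hδ
  have hδ' : δ = 1 - 2 * Complex.I * ∑ j, x.1 j ^ q j * conj (b j)
    - ((r : ℂ) + Complex.I * ∑ j, b j * conj (b j)) * x.2 := rfl
  have hn : 0 < ‖δ‖ ^ 2 := by
    have := norm_pos_iff.2 hx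
    positivity
  have h1 : (x.2 / δ).im = (x.2 * conj δ).im / ‖δ‖ ^ 2 := by
    have : x.2 / δ = x.2 * conj δ / ((‖δ‖ ^ 2 : ℝ) : ℂ) := by
      push_cast
      rw [← Complex.mul_conj', mul_div_mul_right _ _ ((map_ne_zero _).2 hx)]
    rw [this, Complex.div_ofReal_im]
  have h2 : ∀ j, ‖(fractional s q b r x).1 j ^ q j‖ ^ 2 =
      ‖x.1 j ^ q j + b j * x.2‖ ^ 2 / ‖δ‖ ^ 2 := fun j => by
    rw [fractional_pow hq hq_one hb, norm_div, div_pow]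
  have h3 : (x.2 * conj δ).im - ∑ j, ‖x.1 j ^ q j + b j * x.2‖ ^ 2 =
      x.2.im - ∑ j, ‖x.1 j ^ q j‖ ^ 2 := by
    have him : ∀ c : ℂ, (c.im : ℂ) = (c - conj c) / (2 * Complex.I) := by
      intro c
      rw [Complex.sub_conj]
      have := Complex.I_ne_zero
      field_simp
      push_cast
      ring
    apply Complex.ofReal_injective
    push_cast
    simp only [him, ← Complex.mul_conj']
    have hc : conj δ = 1 + 2 * Complex.I * ∑ j, conj (x.1 j ^ q j) * b j
        - ((r : ℂ) - Complex.I * ∑ j, b j * conj (b j)) * conj x.2 := by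
      rw [hδ']
      simp only [map_sub, map_add, map_one, map_mul, map_ofNat, Complex.conj_I, Complex.conj_ofReal,
        map_sum, Complex.conj_conj, mul_comm (conj (b _)) (b _)]
      ring
    have hs : ∑ j, (x.1 j ^ q j + b j * x.2) * conj (x.1 j ^ q j + b j * x.2) =
        ∑ j, x.1 j ^ q j * conj (x.1 j ^ q j) + conj x.2 * (∑ j, x.1 j ^ q j * conj (b j)) +
        x.2 * (∑ j, conj (x.1 j ^ q j) * b j) +
        x.2 * conj x.2 * ∑ j, b j * conj (b j) := by
      simp only [Finset.mul_sum, ← Finset.sum_add_distrib]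
      refine Finset.sum_congr rfl fun j _ => ?_
      simp only [map_add, map_mul]
      ring
    rw [hs, map_mul, Complex.conj_conj, hc, hδ']
    have := Complex.I_ne_zero
    field_simp
    ring
  change ((x.2 / δ).im = ∑ j, ‖(fractional s q b r x).1 j ^ q j‖ ^ 2) ↔ (_ = _)
  rw [h1]
  simp only [h2, ← Finset.sum_div]
  rw [div_left_inj' hn.ne', ← sub_eq_zero, h3, sub_eq_zero]

theorem isLocalAut_fractional {N s : ℕ} {q : Fin N → ℕ} (hq : ∀ j, q j ≠ 0)
    (hq_one : ∀ j, j.val < s → q j = 1) {b : Fin N → ℂ} (hb : ∀ j, s ≤ j.val → b j = 0) (r : ℝ) :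
    IsLocalAut (pseudoEllipsoid q) (fractional s q b r) := by
  have hb' : ∀ j : Fin N, s ≤ j.val → (-b) j = 0 := fun j hj => by simp [hb j hj]
  refine IsLocalAut.of_inverse
    (analyticAt_fractional s (eventually_deltaFun_mem_slitPlane hq b r).self_of_nhds)
    (analyticAt_fractional s (eventually_deltaFun_mem_slitPlane hq (-b) (-r)).self_of_nhds) ?_
    ((eventually_deltaFun_mem_slitPlane hq b r).mono fun x hx =>
      fractional_neg_fractional hq hq_one hb r hx)
    ((eventually_deltaFun_mem_slitPlane hq (-b) (-r)).mono fun x hx => ?_)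
    ((eventually_deltaFun_ne_zero hq b r).mono fun x hx => fractional_mem_iff hq hq_one hb r hx)
  · ext j <;> simp [fractional]
  · have := fractional_neg_fractional hq hq_one hb' (-r) hx
    rwa [neg_neg, neg_neg] at this

theorem isLocalAut_decomposed {N s : ℕ} (hs : s ≤ N) {q : Fin N → ℕ} (hq : ∀ j, q j ≠ 0)
    (hq_one : ∀ j, j.val < s → q j = 1) {σ : Equiv.Perm (Fin N)} (hσ : σ ∈ admissiblePerms s q)
    {t : ℝ} (ht : 0 < t) {U : Matrix (Fin s) (Fin s) ℂ} (hU : U ∈ Matrix.unitaryGroup (Fin s) ℂ)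
    (θ : Fin N → ℝ) {b : Fin N → ℂ} (hb : ∀ j, s ≤ j.val → b j = 0) (r : ℝ) :
    IsLocalAut (pseudoEllipsoid q)
      (dilation q t ∘ blockRotation hs U θ ∘ fractional s q b r ∘ coordPerm σ) :=
  (isLocalAut_dilation hq ht).comp ((isLocalAut_blockRotation hs hq_one hU θ).comp
    ((isLocalAut_fractional hq hq_one hb r).comp (isLocalAut_coordPerm hσ.2)))

/-! ### Continuity in the inductive limit topology -/

theorem HolOn.continuous_toGerm {N : ℕ} (U : TopologicalSpace.OpenNhdsOf (0 : CSpace N)) :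
    Continuous fun F : HolOn U => F.toGerm :=
  continuous_iff_coinduced_le.2
    (le_iSup (fun U : TopologicalSpace.OpenNhdsOf (0 : CSpace N) =>
      TopologicalSpace.coinduced (fun F : HolOn U => F.toGerm) inferInstance) U)

/-- A family of holomorphic maps that depends continuously on parameters defines a continuous family
of germs. -/
theorem HolGerm.continuous_of_family {N : ℕ} {X : Type*} [TopologicalSpace X]
    {F : X → CSpace N → CSpace N} {Ω : Set (X × CSpace N)} (hΩ : IsOpen Ω) (h0 : ∀ p, (p, 0) ∈ Ω)
    (hc : ContinuousOn (Function.uncurry F) Ω) (ha : ∀ p x, (p, x) ∈ Ω → AnalyticAt ℂ (F p) x)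
    {Φ : X → HolGerm N} (hΦ : ∀ p, (Φ p).germ = ↑(F p)) : Continuous Φ := by
  refine continuous_iff_continuousAt.2 fun p₀ => ?_
  obtain ⟨W, V, hW, hpW, hV, h0V, hWV⟩ := mem_nhds_prod_iff'.1 (hΩ.mem_nhds (h0 p₀))
  let V' : TopologicalSpace.OpenNhdsOf (0 : CSpace N) := ⟨⟨V, hV⟩, h0V⟩
  -- Near p₀ the family factors through the holomorphic maps on one fixed neighbourhood `V`;
  -- compactness of `K` gives uniform convergence there.
  let Ψ : W → HolOn V' := fun p => ⟨UniformOnFun.ofFun _ (F p), fun x hx => ha p x (hWV ⟨p.2, hx⟩)⟩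
  have hΨ : Continuous Ψ := by
    refine Continuous.subtype_mk (continuous_iff_continuousAt.2 fun p₁ => ?_) _
    refine UniformOnFun.tendsto_iff_tendstoUniformlyOn.2 fun K hK => ?_
    intro u hu
    have hcK : ContinuousOn (Function.uncurry F) (W ×ˢ K) :=
      hc.mono fun y hy => hWV ⟨hy.1, hK.2 hy.2⟩
    obtain ⟨v, hv, hvu⟩ := hK.1.mem_uniformity_of_prod hcK p₁.2 (tendsto_swap_uniformity hu)
    have hv' := mem_nhdsWithin_iff_exists_mem_nhds_inter.1 hv
    obtain ⟨v', hv', hvv⟩ := hv'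
    filter_upwards [continuous_subtype_val.continuousAt.preimage_mem_nhds hv'] with p hp x hx
    exact hvu p (hvv ⟨hp, p.2⟩) x hx
  have hcomp : W.domRestrict Φ = fun p => (Ψ p).toGerm := by
    ext p
    exact hΦ p
  have hon : ContinuousOn Φ W := by
    rw [continuousOn_iff_continuous_domRestrict, hcomp]
    exact (HolOn.continuous_toGerm V').comp hΨ
  exact hon.continuousAt (hW.mem_nhds hpW)

/-- The derivative at the origin of the `j`-th component in direction of `z_k`. -/
noncomputable def HolGerm.deriv {N : ℕ} (j k : Fin N) (T : HolGerm N) : ℂ :=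
  _root_.deriv (fun c : ℂ => (T.holo.choose (Pi.single k c, 0)).1 j) 0

/-- Frees the derivative from the chosen representative. -/
theorem HolGerm.deriv_eq {N : ℕ} (j k : Fin N) {T : HolGerm N} {f : CSpace N → CSpace N}
    (hf : T.germ = ↑f) : T.deriv j k = _root_.deriv (fun c : ℂ => (f (Pi.single k c, 0)).1 j) 0 := by
  have h1 : T.holo.choose =ᶠ[𝓝 0] f := Germ.coe_eq.1 (T.holo.choose_spec.2.symm.trans hf)
  have h2 : Tendsto (fun c : ℂ => ((Pi.single k c, 0) : CSpace N)) (𝓝 0) (𝓝 0) :=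
    (tendsto_single k).prodMk_nhds tendsto_const_nhds
  refine EventuallyEq.deriv_eq ?_
  filter_upwards [h2.eventually h1] with c hc
  rw [hc]

/-- By the universal property it suffices to argue on each `HolOn U`, where locally uniform
convergence of holomorphic functions implies convergence of derivatives. -/
theorem HolGerm.continuous_deriv {N : ℕ} (j k : Fin N) :
    Continuous fun T : HolGerm N => T.deriv j k := by
  refine continuous_iSup_dom.2 fun U => continuous_coinduced_dom.2 ?_
  let l : ℂ → CSpace N := fun c => (Pi.single k c, 0)
  have hl : Continuous l := (continuous_single (A := fun _ : Fin N => ℂ) k).prodMk continuous_const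
  have hl0 : l 0 = 0 := by simp [l]
  have heq : ((fun T : HolGerm N => T.deriv j k) ∘ fun F : HolOn U => F.toGerm) =
      fun F : HolOn U => _root_.deriv (fun c => (UniformOnFun.toFun _ F.1 (l c)).1 j) 0 :=
    funext fun F => HolGerm.deriv_eq j k rfl
  rw [heq]
  refine continuous_iff_continuousAt.2 fun F₀ => ?_
  have hU : l ⁻¹' (U : Set (CSpace N)) ∈ 𝓝 (0 : ℂ) :=
    hl.continuousAt.preimage_mem_nhds (by rw [hl0]; exact U.1.isOpen.mem_nhds U.mem)
  obtain ⟨ρ, hρ, hball⟩ := Metric.nhds_basis_closedBall.mem_iff.1 hU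
  have hK : IsCompact (l '' Metric.closedBall 0 ρ) := (isCompact_closedBall _ _).image hl
  have hsub : l '' Metric.closedBall 0 ρ ⊆ (U : Set (CSpace N)) := Set.image_subset_iff.2 hball
  have h1 : Tendsto (fun F : HolOn U => F.1) (𝓝 F₀) (𝓝 F₀.1) :=
    continuous_subtype_val.continuousAt
  have h2 := UniformOnFun.tendsto_iff_tendstoUniformlyOn.1 h1 _ ⟨hK, hsub⟩
  have h3 := (h2.comp l).mono
    (Metric.ball_subset_closedBall.trans (Set.subset_preimage_image l (Metric.closedBall 0 ρ)))
  have h4 := ((coordCLM j).uniformContinuous.comp_tendstoUniformlyOn h3).tendstoLocallyUniformlyOn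
  have h5 := h4.deriv (Eventually.of_forall fun F c hc => ?_) Metric.isOpen_ball
  · have h6 := h5.tendsto_at (Metric.mem_ball_self hρ)
    exact h6
  · have hF : DifferentiableAt ℂ (UniformOnFun.toFun _ F.1) (l c) :=
      (F.2 _ (hball (Metric.ball_subset_closedBall hc))).differentiableAt
    have hld : DifferentiableAt ℂ l c := by
      have : l = fun c => c • ((Pi.single k 1, 0) : CSpace N) := by
        ext c i <;> simp [l, Pi.single_apply]
      rw [this]
      fun_prop
    exact ((coordCLM j).differentiableAt.comp c (hF.comp c hld)).differentiableWithinAt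

/-! ### Connectedness of the unitary group -/

-- Some multiple e^{iθ} U does not have the eigenvalue -1, so its operator norm distance from 1 is
-- less than 2 and a path joins it to 1. The multiples of U form a connected set that links it to U.
open scoped Matrix.Norms.L2Operator in
theorem Matrix.unitaryGroup_joined_one {n : ℕ} (U : Matrix.unitaryGroup (Fin n) ℂ) :
    ∃ S : Set (Matrix.unitaryGroup (Fin n) ℂ), IsPreconnected S ∧ 1 ∈ S ∧ U ∈ S := by
  let V : ℝ → Matrix.unitaryGroup (Fin n) ℂ := fun θ =>
    ⟨Complex.exp (θ * Complex.I) • U.1, by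
      have h : star (Complex.exp (θ * Complex.I)) * Complex.exp (θ * Complex.I) = 1 := by
        rw [RCLike.star_def, Complex.conj_mul', Complex.norm_exp_ofReal_mul_I]
        simp
      rw [Matrix.mem_unitaryGroup_iff', star_smul, smul_mul_smul_comm,
        Matrix.mem_unitaryGroup_iff'.1 U.2, h, one_smul]⟩
  have hV : Continuous V := by
    refine Continuous.subtype_mk ?_ _
    fun_prop
  obtain ⟨θ, hθ⟩ : ∃ θ : ℝ, -1 ∉ spectrum ℂ (V θ).1 := by
    by_contra! h
    have hfin : (spectrum ℂ U.1).Finite := Matrix.finite_spectrum U.1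
    -- If -1 were always an eigenvalue of e^{iθ} U, then every -e^{-iθ} would be an eigenvalue of U;
    -- these are distinct for θ in (0, 1).
    refine (Set.infinite_of_injOn_mapsTo (s := Set.Ioo (0 : ℝ) 1)
      (f := fun θ : ℝ => -Complex.exp (-(θ * Complex.I))) ?_ ?_ (Set.Ioo_infinite one_pos)) hfin
    · intro x hx y hy hxy
      have h1 : Complex.exp (x * Complex.I) = Complex.exp (y * Complex.I) := by
        simpa [Complex.exp_neg] using hxy
      have hπ := Real.pi_gt_three
      have h2 := Complex.exp_inj_of_neg_pi_lt_of_le_pi (x := x * Complex.I) (y := y * Complex.I)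
        (by simp; linarith [hx.1]) (by simp; linarith [hx.2]) (by simp; linarith [hy.1])
        (by simp; linarith [hy.2]) h1
      exact_mod_cast mul_right_cancel₀ Complex.I_ne_zero h2
    · intro θ _
      have h1 := h θ
      have h2 : (V θ).1 = Units.mk0 (Complex.exp (θ * Complex.I)) (Complex.exp_ne_zero _) • U.1 :=
        rfl
      rw [h2, spectrum.unit_smul_eq_smul, Set.mem_smul_set_iff_inv_smul_mem] at h1
      simpa [Units.smul_def, Complex.exp_neg] using h1
  have hj : Joined (1 : Matrix.unitaryGroup (Fin n) ℂ) (V θ) :=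
    Unitary.joined _ _ ((Unitary.norm_sub_one_lt_two_iff (V θ).2).2 hθ)
  refine ⟨pathComponent 1 ∪ Set.range V, ?_, Or.inl (mem_pathComponent_self 1), Or.inr ⟨0, ?_⟩⟩
  · exact isPathConnected_pathComponent.isConnected.isPreconnected.union (V θ) hj ⟨θ, rfl⟩
      (isPreconnected_range hV)
  · ext1
    simp [V]

instance Matrix.unitaryGroup_preconnectedSpace {n : ℕ} :
    PreconnectedSpace (Matrix.unitaryGroup (Fin n) ℂ) := by
  refine ⟨isPreconnected_of_forall 1 fun U _ => ?_⟩
  obtain ⟨S, hS, h1, hU⟩ := Matrix.unitaryGroup_joined_one U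
  exact ⟨S, Set.subset_univ _, h1, hU, hS⟩

/-! ### The parameter space of the decomposition -/

/-- The vector `(β, 0)` with the entries of index `≥ s` replaced by zero. -/
def truncate {N : ℕ} (s : ℕ) (β : Fin N → ℂ) (j : Fin N) : ℂ := if j.val < s then β j else 0

theorem truncate_of_le {N s : ℕ} (β : Fin N → ℂ) {j : Fin N} (hj : s ≤ j.val) :
    truncate s β j = 0 := if_neg (not_lt.2 hj)

theorem truncate_eq_self {N s : ℕ} {b : Fin N → ℂ} (hb : ∀ j, s ≤ j.val → b j = 0) :
    truncate s b = b := by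
  ext j
  rcases lt_or_ge j.val s with hj | hj
  · exact if_pos hj
  · rw [truncate_of_le b hj, hb j hj]

theorem continuous_truncate {N s : ℕ} : Continuous (truncate s : (Fin N → ℂ) → Fin N → ℂ) := by
  refine continuous_pi fun j => ?_
  simp only [truncate]
  split_ifs <;> fun_prop

/-- The parameters `(τ, U, θ, β, r)` of the decomposition, with `t = exp τ`. -/
abbrev DecompParam (N s : ℕ) : Type :=
  ℝ × Matrix.unitaryGroup (Fin s) ℂ × (Fin N → ℝ) × (Fin N → ℂ) × ℝ

/-- The map with the given parameters. -/
noncomputable def decomposedMap {N s : ℕ} (hs : s ≤ N) (q : Fin N → ℕ) (σ : Equiv.Perm (Fin N))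
    (p : DecompParam N s) : CSpace N → CSpace N :=
  dilation q (Real.exp p.1) ∘ blockRotation hs p.2.1.1 p.2.2.1 ∘
    fractional s q (truncate s p.2.2.2.1) p.2.2.2.2 ∘ coordPerm σ

/-- `Real.exp` and `truncate` absorb the constraints t > 0 and b = (β, 0), so the parameters range
over a product of connected spaces. -/
theorem mem_decomposedGerms_iff {N s : ℕ} (hs : s ≤ N) (q : Fin N → ℕ) (σ : Equiv.Perm (Fin N))
    (T : HolGerm N) :
    T ∈ decomposedGerms hs q σ ↔ ∃ p : DecompParam N s, T.germ = ↑(decomposedMap hs q σ p) := by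
  constructor
  · rintro ⟨t, U, θ, b, r, ht, hU, hb, hT⟩
    refine ⟨(Real.log t, ⟨U, hU⟩, θ, b, r), ?_⟩
    rw [hT, decomposedMap]
    simp only [Real.exp_log ht, truncate_eq_self hb]
  · rintro ⟨⟨τ, U, θ, β, r⟩, hT⟩
    exact ⟨Real.exp τ, U.1, θ, truncate s β, r, Real.exp_pos τ, U.2, fun j => truncate_of_le β, hT⟩

theorem Continuous.deltaFun {N : ℕ} (q : Fin N → ℕ) {X : Type*} [TopologicalSpace X]
    {b : X → Fin N → ℂ} {r : X → ℝ} {x : X → CSpace N} (hb : Continuous b) (hr : Continuous r)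
    (hx : Continuous x) : Continuous fun y => deltaFun q (b y) (r y) (x y) := by
  unfold _root_.deltaFun
  fun_prop

theorem continuous_coordPerm {N : ℕ} (σ : Equiv.Perm (Fin N)) :
    Continuous (coordPerm σ : CSpace N → CSpace N) := by
  unfold coordPerm
  fun_prop

theorem ContinuousOn.blockRotation {N s : ℕ} (hs : s ≤ N) {X : Type*} [TopologicalSpace X]
    {S : Set X} {U : X → Matrix (Fin s) (Fin s) ℂ} {θ : X → Fin N → ℝ} {x : X → CSpace N}
    (hU : Continuous U) (hθ : Continuous θ) (hx : ContinuousOn x S) :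
    ContinuousOn (fun y => blockRotation hs (U y) (θ y) (x y)) S := by
  have h1 : ∀ j, ContinuousOn (fun y => (x y).1 j) S := continuousOn_pi.1 hx.fst
  refine ContinuousOn.prodMk (continuousOn_pi.2 fun j => ?_) hx.snd
  by_cases hj : j.val < s
  · simp only [hj, dif_pos, Matrix.vecMul, dotProduct]
    exact continuousOn_finsetSum _ fun i _ =>
      (h1 _).mul (by fun_prop : Continuous fun y => U y i ⟨j.val, hj⟩).continuousOn
  · simp only [hj, dif_neg, not_false_eq_true]
    exact (by fun_prop : Continuous fun y => Complex.exp (Complex.I * (θ y j : ℂ))).continuousOn.mul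
      (h1 j)

theorem ContinuousOn.dilation_exp {N : ℕ} (q : Fin N → ℕ) {X : Type*} [TopologicalSpace X]
    {S : Set X} {τ : X → ℝ} {x : X → CSpace N} (hτ : Continuous τ) (hx : ContinuousOn x S) :
    ContinuousOn (fun y => dilation q (Real.exp (τ y)) (x y)) S := by
  have h : ∀ j, Continuous fun y => Real.exp (τ y) ^ (1 / (q j : ℝ)) := fun j =>
    (Real.continuous_exp.comp hτ).rpow_const fun p => Or.inl (Real.exp_pos _).ne'
  have h1 : ∀ j, ContinuousOn (fun y => (x y).1 j) S := continuousOn_pi.1 hx.fst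
  refine ContinuousOn.prodMk (continuousOn_pi.2 fun j =>
    (Complex.continuous_ofReal.comp (h j)).continuousOn.mul (h1 j)) ?_
  exact (by fun_prop : Continuous fun y => ((Real.exp (τ y) : ℝ) : ℂ) ^ 2).continuousOn.mul hx.snd

/-- The set where the branches of the roots in `decomposedMap` are holomorphic. -/
def decompDomain {N : ℕ} (s : ℕ) (q : Fin N → ℕ) (σ : Equiv.Perm (Fin N)) :
    Set (DecompParam N s × CSpace N) :=
  {y | deltaFun q (truncate s y.1.2.2.2.1) y.1.2.2.2.2 (coordPerm σ y.2) ∈ Complex.slitPlane}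

theorem continuous_deltaFun_param {N s : ℕ} (q : Fin N → ℕ) (σ : Equiv.Perm (Fin N)) :
    Continuous fun y : DecompParam N s × CSpace N =>
      deltaFun q (truncate s y.1.2.2.2.1) y.1.2.2.2.2 (coordPerm σ y.2) := by
  have h1 : Continuous fun y : DecompParam N s × CSpace N => truncate s y.1.2.2.2.1 :=
    continuous_truncate.comp continuous_fst.snd.snd.snd.fst
  have h2 : Continuous fun y : DecompParam N s × CSpace N => coordPerm σ y.2 :=
    (continuous_coordPerm σ).comp continuous_snd
  have h3 : Continuous fun y : DecompParam N s × CSpace N => y.1.2.2.2.2 :=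
    continuous_fst.snd.snd.snd.snd
  exact h1.deltaFun q h3 h2

theorem continuousOn_fractional_param {N s : ℕ} (q : Fin N → ℕ) (σ : Equiv.Perm (Fin N)) :
    ContinuousOn (fun y : DecompParam N s × CSpace N =>
      fractional s q (truncate s y.1.2.2.2.1) y.1.2.2.2.2 (coordPerm σ y.2))
      (decompDomain s q σ) := by
  have hδ := (continuous_deltaFun_param (s := s) q σ).continuousOn (s := decompDomain s q σ)
  have hδ0 : ∀ y ∈ decompDomain s q σ,
      deltaFun q (truncate s y.1.2.2.2.1) y.1.2.2.2.2 (coordPerm σ y.2) ≠ 0 :=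
    fun y hy => Complex.slitPlane_ne_zero hy
  have h1 : Continuous fun y : DecompParam N s × CSpace N => truncate s y.1.2.2.2.1 :=
    continuous_truncate.comp continuous_fst.snd.snd.snd.fst
  have h2 : Continuous fun y : DecompParam N s × CSpace N => coordPerm σ y.2 :=
    (continuous_coordPerm σ).comp continuous_snd
  have h3 : ∀ j, Continuous fun y : DecompParam N s × CSpace N => (coordPerm σ y.2).1 j :=
    continuous_pi_iff.1 h2.fst
  refine ContinuousOn.prodMk (continuousOn_pi.2 fun j => ?_) ?_
  · by_cases hj : j.val < s
    · simp only [hj, if_true]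
      exact ((h3 j).add ((continuous_pi_iff.1 h1 j).mul h2.snd)).continuousOn.div hδ hδ0
    · simp only [hj, if_false]
      refine (h3 j).continuousOn.div (hδ.cpow continuousOn_const fun y hy => hy) fun y hy => ?_
      rw [Complex.cpow_ne_zero_iff]
      exact Or.inl (hδ0 y hy)
  · exact ContinuousOn.div h2.snd.continuousOn hδ hδ0

theorem continuousOn_decomposedMap {N s : ℕ} (hs : s ≤ N) (q : Fin N → ℕ)
    (σ : Equiv.Perm (Fin N)) :
    ContinuousOn (Function.uncurry (decomposedMap hs q σ)) (decompDomain s q σ) := by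
  have hU : Continuous fun y : DecompParam N s × CSpace N => y.1.2.1.1 :=
    continuous_subtype_val.comp continuous_fst.snd.fst
  have hθ : Continuous fun y : DecompParam N s × CSpace N => y.1.2.2.1 :=
    continuous_fst.snd.snd.fst
  have hτ : Continuous fun y : DecompParam N s × CSpace N => y.1.1 := continuous_fst.fst
  exact ContinuousOn.dilation_exp q hτ (ContinuousOn.blockRotation hs hU hθ
    (continuousOn_fractional_param q σ))

theorem isOpen_decompDomain {N : ℕ} (s : ℕ) (q : Fin N → ℕ) (σ : Equiv.Perm (Fin N)) :
    IsOpen (decompDomain s q σ) :=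
  Complex.isOpen_slitPlane.preimage (continuous_deltaFun_param q σ)

theorem analyticAt_decomposedMap {N s : ℕ} (hs : s ≤ N) {q : Fin N → ℕ} {σ : Equiv.Perm (Fin N)}
    {p : DecompParam N s} {x : CSpace N} (h : (p, x) ∈ decompDomain s q σ) :
    AnalyticAt ℂ (decomposedMap hs q σ p) x :=
  (analyticAt_dilation q _ _).comp ((analyticAt_blockRotation hs _ _ _).comp
    ((analyticAt_fractional s h).comp (analyticAt_coordPerm σ x)))

theorem coordPerm_zero {N : ℕ} (σ : Equiv.Perm (Fin N)) : coordPerm σ (0 : CSpace N) = 0 := rfl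

/-! ### Derivatives that detect the permutation -/

/-- The derivatives of the maps in the decomposition in the coordinates of index `≥ s`. -/
theorem deriv_decomposedMap {N s : ℕ} (hs : s ≤ N) {q : Fin N → ℕ} (hq : ∀ j, q j ≠ 0)
    (σ : Equiv.Perm (Fin N)) (p : DecompParam N s) {j : Fin N} (hj : s ≤ j.val) (k : Fin N) :
    deriv (fun c : ℂ => (decomposedMap hs q σ p (Pi.single k c, 0)).1 j) 0 ≠ 0 ↔ σ j = k := by
  have hform : ∀ c : ℂ, (decomposedMap hs q σ p (Pi.single k c, 0)).1 j =
      ((Real.exp p.1 ^ (1 / (q j : ℝ)) : ℝ) : ℂ) * (Complex.exp (Complex.I * p.2.2.1 j) *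
        ((Pi.single k c : Fin N → ℂ) (σ j) / deltaFun q (truncate s p.2.2.2.1) p.2.2.2.2
          (coordPerm σ (Pi.single k c, 0)) ^ (1 / (q j : ℂ)))) := by
    intro c
    simp [decomposedMap, dilation, blockRotation, fractional, not_lt.2 hj, coordPerm]
  simp only [hform]
  by_cases hk : σ j = k
  · simp only [hk, Pi.single_eq_same, iff_true]
    set D : ℂ → ℂ := fun c => deltaFun q (truncate s p.2.2.2.1) p.2.2.2.2
      (coordPerm σ (Pi.single k c, 0)) with hD
    have hD0 : D 0 = 1 := by
      have : ((Pi.single k (0 : ℂ), 0) : CSpace N) = 0 := by simp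
      simp only [hD, this, coordPerm_zero, deltaFun_zero hq]
    have hDd : DifferentiableAt ℂ D 0 := by
      have h1 : (fun c : ℂ => ((Pi.single k c, 0) : CSpace N)) =
          fun c => c • ((Pi.single k 1, 0) : CSpace N) := by
        ext c i <;> simp [Pi.single_apply]
      have h2 : DifferentiableAt ℂ (fun c : ℂ => ((Pi.single k c, 0) : CSpace N)) 0 := by
        rw [h1]
        fun_prop
      exact (analyticAt_deltaFun q _ _ _).differentiableAt.comp (0 : ℂ)
        ((analyticAt_coordPerm σ _).differentiableAt.comp (0 : ℂ) h2)
    have hDp : DifferentiableAt ℂ (fun c => D c ^ (1 / (q j : ℂ))) 0 :=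
      hDd.cpow (differentiableAt_const _) (by simp [hD0])
    -- As D(0) = 1 and the numerator vanishes at 0, the root contributes nothing: the derivative is
    -- t^{1/q_j} e^{iθ_j} with t = e^τ.
    have hder := ((hasDerivAt_id (0 : ℂ)).div hDp.hasDerivAt (by simp [hD0])).const_mul
      (Complex.exp (Complex.I * p.2.2.1 j))
    have hder' := hder.const_mul ((Real.exp p.1 ^ (1 / (q j : ℝ)) : ℝ) : ℂ)
    have := hder'.deriv
    simp only [id, hD0, Complex.one_cpow, zero_mul, sub_zero, one_pow, div_one,
      mul_one] at this
    refine (ne_of_eq_of_ne this ?_)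
    refine mul_ne_zero ?_ (Complex.exp_ne_zero _)
    exact_mod_cast (Real.rpow_pos_of_pos (Real.exp_pos _) _).ne'
  · simp [hk]

theorem deriv_ne_zero_iff_of_mem {N s : ℕ} (hs : s ≤ N) {q : Fin N → ℕ} (hq : ∀ j, q j ≠ 0)
    {σ : Equiv.Perm (Fin N)} {T : HolGerm N} (hT : T ∈ decomposedGerms hs q σ) {j : Fin N}
    (hj : s ≤ j.val) (k : Fin N) : T.deriv j k ≠ 0 ↔ σ j = k := by
  obtain ⟨p, hp⟩ := (mem_decomposedGerms_iff hs q σ T).1 hT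
  rw [HolGerm.deriv_eq j k hp]
  exact deriv_decomposedMap hs hq σ p hj k

theorem admissiblePerms_ext {N s : ℕ} {q : Fin N → ℕ} {σ τ : Equiv.Perm (Fin N)}
    (hσ : σ ∈ admissiblePerms s q) (hτ : τ ∈ admissiblePerms s q)
    (h : ∀ j : Fin N, s ≤ j.val → σ j = τ j) : σ = τ := by
  ext1 j
  rcases lt_or_ge j.val s with hj | hj
  · rw [hσ.1 j hj, hτ.1 j hj]
  · exact h j hj

/-! ### The connected components -/

theorem stabilityGroup_eq_iUnion {N s : ℕ} (hN : 1 ≤ N) (hs : s ≤ N) {q : Fin N → ℕ}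
    (hq_one : ∀ j, j.val < s → q j = 1) (hq_two : ∀ j, s ≤ j.val → 2 ≤ q j)
    (hq : ∀ j, q j ≠ 0) :
    stabilityGroup q = ⋃ σ ∈ admissiblePerms s q, decomposedGerms hs q σ := by
  ext T
  simp only [Set.mem_iUnion]
  constructor
  · rintro ⟨f, hf, hfa⟩
    obtain ⟨σ, hσ, t, U, θ, b, r, ht, hU, hb, h⟩ := hfa.exists_decomposition hN hs hq_one hq_two
    exact ⟨σ, hσ, t, U, θ, b, r, ht, hU, hb, hf.trans (Germ.coe_eq.2 h)⟩
  · rintro ⟨σ, hσ, t, U, θ, b, r, ht, hU, hb, h⟩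
    exact ⟨_, h, isLocalAut_decomposed hs hq hq_one hσ ht hU θ hb r⟩

theorem coordPerm_mem_decomposedGerms {N s : ℕ} (hs : s ≤ N) (q : Fin N → ℕ)
    (σ : Equiv.Perm (Fin N)) {T : HolGerm N} (hT : T.germ = ↑(coordPerm σ : CSpace N → CSpace N)) :
    T ∈ decomposedGerms hs q σ := by
  refine ⟨1, 1, 0, 0, 0, one_pos, one_mem _, fun _ _ => rfl, hT.trans ?_⟩
  congr 1
  ext x j
  · simp only [Function.comp, dilation, blockRotation, Matrix.vecMul_one]
    split_ifs with hj
    · simp [fractional, deltaFun]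
    · simp [fractional, deltaFun]
  · simp [dilation, blockRotation, fractional, deltaFun]

theorem isPreconnected_decomposedGerms {N s : ℕ} (hs : s ≤ N) {q : Fin N → ℕ} (hq : ∀ j, q j ≠ 0)
    (hq_one : ∀ j, j.val < s → q j = 1) {σ : Equiv.Perm (Fin N)} (hσ : σ ∈ admissiblePerms s q) :
    IsPreconnected {T : stabilityGroup q | T.1 ∈ decomposedGerms hs q σ} := by
  let Φ : DecompParam N s → stabilityGroup q := fun p =>
    stabilityGroup.mk (decomposedMap hs q σ p) (isLocalAut_decomposed hs hq hq_one hσ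
      (Real.exp_pos _) p.2.1.2 _ (fun _ => truncate_of_le _) _)
  have hΦ : Continuous Φ := by
    refine continuous_induced_rng.2 ?_
    refine HolGerm.continuous_of_family (isOpen_decompDomain s q σ) (fun p => ?_)
      (continuousOn_decomposedMap hs q σ) (fun p x => analyticAt_decomposedMap hs) fun p => rfl
    simp [decompDomain, coordPerm_zero, deltaFun_zero hq]
  have hrange : {T : stabilityGroup q | T.1 ∈ decomposedGerms hs q σ} = Set.range Φ := by
    ext T
    change T.1 ∈ decomposedGerms hs q σ ↔ T ∈ Set.range Φ
    rw [mem_decomposedGerms_iff]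
    constructor
    · rintro ⟨p, hp⟩
      exact ⟨p, Subtype.ext (HolGerm.ext hp.symm)⟩
    · rintro ⟨p, rfl⟩
      exact ⟨p, rfl⟩
  rw [hrange]
  exact isPreconnected_range hΦ

/-- Finitely many continuous derivatives being nonzero singles out σ, so each family is open. Its
complement is the union of the other families, which are open for the same reason. -/
theorem isClopen_decomposedGerms {N s : ℕ} (hN : 1 ≤ N) (hs : s ≤ N) {q : Fin N → ℕ}
    (hq_one : ∀ j, j.val < s → q j = 1) (hq_two : ∀ j, s ≤ j.val → 2 ≤ q j)
    (hq : ∀ j, q j ≠ 0) {σ : Equiv.Perm (Fin N)} (hσ : σ ∈ admissiblePerms s q) :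
    IsClopen {T : stabilityGroup q | T.1 ∈ decomposedGerms hs q σ} := by
  have hex : ∀ T : stabilityGroup q, ∃ τ ∈ admissiblePerms s q, T.1 ∈ decomposedGerms hs q τ := by
    intro T
    have := T.2
    simpa using (stabilityGroup_eq_iUnion hN hs hq_one hq_two hq).subset this
  have hopen : ∀ σ ∈ admissiblePerms s q,
      IsOpen {T : stabilityGroup q | T.1 ∈ decomposedGerms hs q σ} := by
    intro σ hσ
    have heq : {T : stabilityGroup q | T.1 ∈ decomposedGerms hs q σ} =
        ⋂ j : {j : Fin N // s ≤ j.val}, {T : stabilityGroup q | T.1.deriv j.1 (σ j.1) ≠ 0} := by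
      ext T
      simp only [Set.mem_iInter]
      refine ⟨fun hT j => (deriv_ne_zero_iff_of_mem hs hq hT j.2 _).2 rfl, fun h => ?_⟩
      obtain ⟨τ, hτ, hT⟩ := hex T
      have : τ = σ := admissiblePerms_ext hτ hσ fun j hj =>
        (deriv_ne_zero_iff_of_mem hs hq hT hj _).1 (h ⟨j, hj⟩)
      exact this ▸ hT
    rw [heq]
    exact isOpen_iInter_of_finite fun j => isOpen_ne_fun
      ((HolGerm.continuous_deriv j.1 (σ j.1)).comp continuous_subtype_val) continuous_const
  refine ⟨⟨?_⟩, hopen σ hσ⟩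
  have hcompl : {T : stabilityGroup q | T.1 ∈ decomposedGerms hs q σ}ᶜ =
      ⋃ τ ∈ admissiblePerms s q \ {σ}, {T : stabilityGroup q | T.1 ∈ decomposedGerms hs q τ} := by
    ext T
    simp only [Set.mem_compl_iff, Set.mem_iUnion]
    constructor
    · intro h
      obtain ⟨τ, hτ, hT⟩ := hex T
      exact ⟨τ, ⟨hτ, fun h' => h (h' ▸ hT)⟩, hT⟩
    · rintro ⟨τ, ⟨hτ, hne⟩, hT⟩ h
      exact hne (admissiblePerms_ext hτ hσ fun j hj =>
        (deriv_ne_zero_iff_of_mem hs hq hT hj _).1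
          ((deriv_ne_zero_iff_of_mem hs hq h hj (σ j)).2 rfl))
  rw [hcompl]
  exact isOpen_biUnion fun τ hτ => hopen τ hτ.1

theorem theorem4 (N s : ℕ) (hN : 1 ≤ N) (hs : s ≤ N) (q : Fin N → ℕ)
    (hq_one : ∀ j, j.val < s → q j = 1) (hq_two : ∀ j, s ≤ j.val → 2 ≤ q j) :
    -- the stability group consists exactly of the germs of the compositions
    (stabilityGroup q = ⋃ σ ∈ admissiblePerms s q, decomposedGerms hs q σ) ∧
    -- the identity component is given by `σ = Id`
    connectedComponent (1 : stabilityGroup q) =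
      {T : stabilityGroup q | T.1 ∈ decomposedGerms hs q 1} ∧
    -- each admissible `σ` gives a connected component
    (∀ σ ∈ admissiblePerms s q, ∃ S : stabilityGroup q, S.1.germ = ↑(coordPerm σ) ∧
      connectedComponent S = {T : stabilityGroup q | T.1 ∈ decomposedGerms hs q σ}) ∧
    -- different `σ` give different components
    (∀ σ ∈ admissiblePerms s q, ∀ τ ∈ admissiblePerms s q, σ ≠ τ →
      Disjoint (decomposedGerms hs q σ) (decomposedGerms hs q τ)) := by
  have hq : ∀ j, q j ≠ 0 := by
    intro j
    rcases lt_or_ge j.val s with hj | hj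
    · rw [hq_one j hj]
      exact one_ne_zero
    · have := hq_two j hj
      omega
  -- A clopen set contains the component of each of its points, and a preconnected set lies in it.
  have hcomp : ∀ σ ∈ admissiblePerms s q, ∀ S : stabilityGroup q, S.1.germ = ↑(coordPerm σ) →
      connectedComponent S = {T : stabilityGroup q | T.1 ∈ decomposedGerms hs q σ} := by
    intro σ hσ S hS
    have hmem : S ∈ {T : stabilityGroup q | T.1 ∈ decomposedGerms hs q σ} :=
      coordPerm_mem_decomposedGerms hs q σ hS
    exact Set.Subset.antisymm
      ((isClopen_decomposedGerms hN hs hq_one hq_two hq hσ).connectedComponent_subset hmem)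
      ((isPreconnected_decomposedGerms hs hq hq_one hσ).subset_connectedComponent hmem)
  refine ⟨stabilityGroup_eq_iUnion hN hs hq_one hq_two hq,
    hcomp 1 ⟨fun _ _ => rfl, fun _ => rfl⟩ 1 rfl, fun σ hσ =>
      ⟨stabilityGroup.mk (coordPerm σ) (isLocalAut_coordPerm hσ.2), rfl, hcomp σ hσ _ rfl⟩, ?_⟩
  intro σ hσ τ hτ hne
  refine Set.disjoint_left.2 fun T hTσ hTτ => hne (admissiblePerms_ext hσ hτ fun j hj => ?_)
  exact (deriv_ne_zero_iff_of_mem hs hq hTσ hj _).1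
    ((deriv_ne_zero_iff_of_mem hs hq hTτ hj (τ j)).2 rfl)
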